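/- **Setting.** Let $C\subseteq\mathbb R^d$ be a closed set (the configuration space) with locally Lipschitz boundary, in the sense of the interior cone property: for every boundary point $x_0$ there are $e\in\mathbb R^d$ and $\varepsilon>0$ such that $B(x+te,\varepsilon t)\subseteq C$ for all $x\in C\cap B(x_0,\varepsilon)$ and $0<t<\varepsilon$ (for instance $C=\mathbb R^d$ or a box). Let $C_{obs}$ be an arbitrary obstacle set, $C_{free}=C\setminus C_{obs}$, and let the speed $S:C\to(0,\infty)$ be continuous and bounded above. **Viscosity solution.** A time field $T(s,g)$ is a viscosity solution of the Eikonal equation $\|\nabla_g T(s,g)\|=1/S(g)$ if for every $s\in C_{free}$ the function $u=T(s,\cdot)$ is continuous and nonnegative on $C$, $u(s)=0$, and for every $v\in C^\infty(\mathbb R^d)$ and every $x_0\neq s$: 1. if $x_0$ is an interior point of $C$ and $u-v$ has a local maximum at $x_0$, then $\|\nabla v(x_0)\|-1/S(x_0)\le 0$; 2. if $x_0\in C$ and $u-v$, as a function on $C$, has a local minimum at $x_0$, then $\|\nabla v(x_0)\|-1/S(x_0)\ge 0$. **Paths and waypoints.** A waypoint from $s$ to $g$ is a point $w\notin\{s,g\}$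 that lies on a path from $s$ to $g$ of one of the following kinds: * an optimal path: a Lipschitz curve $\gamma:[0,1]\to C$ from $s$ to $g$ that minimizes the travel time $\int_0^1\|\gamma'(t)\|/S(\gamma(t))\,dt$ among all such curves; * a path planned from $T$ by gradient descent: a continuous curve $\gamma$ on some $[0,\tau]$ with $\gamma(0)=g$, $\gamma(\tau)=s$ such that for $0<t<\tau$ the point $\gamma(t)$ is interior to $C$, $T(s,\cdot)$ is differentiable at $\gamma(t)$, and $\gamma'=-S(\gamma)^2\nabla_gT(s,\gamma)$; * a path planned from $T$ by bidirectional gradient descent: two continuous curves $a,b$ on some $[0,\tau]$ with $a(0)=s$, $b(0)=g$, $a(\tau)=b(\tau)$ such that for $0<t<\tau$ the points $a(t),b(t)$ are interior to $C_{free}$, $T$ is differentiable at $(a(t),b(t))$, $a'=-S(a)^2\nabla_sT(a,b)$ and $b'=-S(b)^2\nabla_gT(a,b)$; the path is the union of the two curves. The time field $T$ satisfies the *monotonic constraints* if $T(s,g)>T(s,w)$ and $T(s,g)>T(w,g)$ for all $s,g,w\in C_{free}$ such that $w$ is a waypoint from $s$ to $g$. **Proposition.** Let $T$ be a time field that violates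 the monotonic constraints, i.e. there are $s,g\in C_{free}$ and a waypoint $w\in C_{free}$ from $s$ to $g$ with $T(s,g)\le T(s,w)$ or $T(s,g)\le T(w,g)$. Then $T$ is not a viscosity solution of the Eikonal equation. -/

import Mathlib

open Set Filter Topology
open scoped ContDiff

namespace Eikonal

/-- Configurations are points of `ℝ^d` with its Euclidean norm. -/
abbrev Conf (d : ℕ) := EuclideanSpace ℝ (Fin d)

/-- The free space `C \ C_obs`. -/
def free {d : ℕ} (C Cobs : Set (Conf d)) : Set (Conf d) := C \ Cobs

/-- `C` has a (locally) Lipschitz boundary, in the form of the uniform interior cone property: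
near every boundary point there is one fixed open truncated cone whose translate to each nearby
point of `C` stays in `C`. The condition is empty if `C` has no boundary, e.g. if `C` is the
whole space. -/
def HasLipschitzBoundary {d : ℕ} (C : Set (Conf d)) : Prop :=
  ∀ x₀ ∈ frontier C, ∃ e : Conf d, ∃ ε : ℝ, 0 < ε ∧
    ∀ x ∈ C ∩ Metric.ball x₀ ε, ∀ t ∈ Ioo (0 : ℝ) ε, Metric.ball (x + t • e) (ε * t) ⊆ C

/-- The Hamiltonian `G(x, p) = ‖p‖ - S(x)⁻¹` of the Eikonal equation `‖∇T(x)‖ = S(x)⁻¹`. -/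
noncomputable def hamiltonian {d : ℕ} (S : Conf d → ℝ) (x p : Conf d) : ℝ := ‖p‖ - (S x)⁻¹

/-- `u` is a viscosity solution on `C` of `‖∇u‖ = 1 / S` for the point source `s`. The equation
is imposed away from the source, where `u` vanishes. Condition `sub` is required at the interior
points of `C` and `super` at all points of `C`, boundary included, with local extrema taken
relative to `C`; this is the usual state-constraint boundary condition, and there is nothing to
require at the boundary when `C` is the whole space. -/
structure IsViscositySolutionFrom {d : ℕ} (C : Set (Conf d)) (S : Conf d → ℝ) (s : Conf d)
    (u : Conf d → ℝ) : Prop where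
  cont : ContinuousOn u C
  nonneg : ∀ x ∈ C, 0 ≤ u x
  source : u s = 0
  sub : ∀ v : Conf d → ℝ, ContDiff ℝ ∞ v → ∀ x₀ ∈ interior C, x₀ ≠ s →
    IsLocalMaxOn (fun x => u x - v x) C x₀ → hamiltonian S x₀ (gradient v x₀) ≤ 0
  super : ∀ v : Conf d → ℝ, ContDiff ℝ ∞ v → ∀ x₀ ∈ C, x₀ ≠ s →
    IsLocalMinOn (fun x => u x - v x) C x₀ → 0 ≤ hamiltonian S x₀ (gradient v x₀)

/-- A time field `T(s, g)` is a viscosity solution of the Eikonal equation in the variable `g`,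
for every start `s` in the free space. -/
def IsViscositySolution {d : ℕ} (C Cobs : Set (Conf d)) (S : Conf d → ℝ)
    (T : Conf d → Conf d → ℝ) : Prop :=
  ∀ s ∈ free C Cobs, IsViscositySolutionFrom C S s (T s)

/-- Lipschitz curves in `C` from `s` to `g`, parametrized by `[0, 1]`. -/
structure IsCurve {d : ℕ} (C : Set (Conf d)) (s g : Conf d) (γ : ℝ → Conf d) : Prop where
  lipschitz : ∃ K, LipschitzOnWith K γ (Icc 0 1)
  mapsTo : MapsTo γ (Icc 0 1) C
  start : γ 0 = s
  goal : γ 1 = g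

/-- The time needed to run through the curve `γ` at speed `S`. -/
noncomputable def travelTime {d : ℕ} (S : Conf d → ℝ) (γ : ℝ → Conf d) : ℝ :=
  ∫ t in (0 : ℝ)..1, ‖deriv γ t‖ / S (γ t)

/-- `w` lies on an optimal path: a curve in `C` from `s` to `g` of least travel time. -/
def OnOptimalPath {d : ℕ} (C : Set (Conf d)) (S : Conf d → ℝ) (s g w : Conf d) : Prop :=
  ∃ γ : ℝ → Conf d, IsCurve C s g γ ∧
    (∀ η : ℝ → Conf d, IsCurve C s g η → travelTime S γ ≤ travelTime S η) ∧
    w ∈ γ '' Icc 0 1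

/-- `w` lies on a path planned from the time field `T` by gradient descent from the goal back to
the start: `γ' = - S(γ)² ∇_g T(s, γ)`. -/
def OnDescentPath {d : ℕ} (C : Set (Conf d)) (S : Conf d → ℝ) (T : Conf d → Conf d → ℝ)
    (s g w : Conf d) : Prop :=
  ∃ (τ : ℝ) (γ : ℝ → Conf d), 0 ≤ τ ∧ ContinuousOn γ (Icc 0 τ) ∧ γ 0 = g ∧ γ τ = s ∧
    (∀ t ∈ Ioo 0 τ, γ t ∈ interior C ∧ DifferentiableAt ℝ (T s) (γ t) ∧
      HasDerivAt γ (-(S (γ t) ^ 2 • gradient (T s) (γ t))) t) ∧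
    w ∈ γ '' Icc 0 τ

/-- `w` lies on a path planned from the time field `T` by bidirectional gradient descent: a curve
`a` issuing from the start and a curve `b` issuing from the goal descend along `∇_s T(a, b)` and
`∇_g T(a, b)` simultaneously, until they meet. -/
def OnBidirectionalPath {d : ℕ} (C Cobs : Set (Conf d)) (S : Conf d → ℝ)
    (T : Conf d → Conf d → ℝ) (s g w : Conf d) : Prop :=
  ∃ (τ : ℝ) (a b : ℝ → Conf d), 0 ≤ τ ∧ ContinuousOn a (Icc 0 τ) ∧ ContinuousOn b (Icc 0 τ) ∧
    a 0 = s ∧ b 0 = g ∧ a τ = b τ ∧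
    (∀ t ∈ Ioo 0 τ, a t ∈ interior (free C Cobs) ∧ b t ∈ interior (free C Cobs) ∧
      DifferentiableAt ℝ (fun p : Conf d × Conf d => T p.1 p.2) (a t, b t) ∧
      HasDerivAt a (-(S (a t) ^ 2 • gradient (fun x => T x (b t)) (a t))) t ∧
      HasDerivAt b (-(S (b t) ^ 2 • gradient (fun y => T (a t) y) (b t))) t) ∧
    w ∈ a '' Icc 0 τ ∪ b '' Icc 0 τ

/-- `w` is a waypoint, different from the two end points, of a path from `s` to `g`: of an optimal
path, or of a path planned from `T` by gradient descent, one-way or bidirectional. -/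
def IsWaypoint {d : ℕ} (C Cobs : Set (Conf d)) (S : Conf d → ℝ) (T : Conf d → Conf d → ℝ)
    (s g w : Conf d) : Prop :=
  w ≠ s ∧ w ≠ g ∧
    (OnOptimalPath C S s g w ∨ OnDescentPath C S T s g w ∨ OnBidirectionalPath C Cobs S T s g w)

/-- The monotonic constraints for the time field `T`. -/
def MonotonicConstraints {d : ℕ} (C Cobs : Set (Conf d)) (S : Conf d → ℝ)
    (T : Conf d → Conf d → ℝ) : Prop :=
  ∀ s ∈ free C Cobs, ∀ g ∈ free C Cobs, ∀ w ∈ free C Cobs, IsWaypoint C Cobs S T s g w →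
    T s w < T s g ∧ T w g < T s g

end Eikonal

/-!
A viscosity solution `T` satisfies the monotonic constraints because `T s` is the travel time from
`s` along curves in `C`: no curve from `s` to `g` is faster than `T s g`, and one curve attains it.

*No curve is faster* (`IsViscositySolutionFrom.le_add_integral`). The subsolution property, tested
with quadratic functions, bounds the pointwise growth rate of `u = T s` in the interior of `C` by
`1 / S` (`eventually_sub_le`). Continuous induction turns this into a bound along curves in the
interior. Curves that touch the boundary are shifted into the interior along the cones of the
Lipschitz boundary; the travel time and `u` change continuously.

*A curve attains it* (`IsViscositySolutionFrom.exists_curve`). The supersolution property shows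
that from every point of `C` except `s` there are arbitrarily short jumps inside `C` along which
`u` drops at a rate close to `1 / S` (`exists_descent`). Chains of such jumps get arbitrarily close
to `s`, because `u` has a minimum on the compact closure of the set that they reach. Parametrized
by the drop of `u`, the chains converge, as the jumps become shorter, to a curve in `C` of speed at
most `S` that runs from `g` to `s` in the time `u g`.

Consequently `T` is symmetric and satisfies the triangle inequality on the free space, it is
positive off the diagonal, and gradients with respect to either variable have norm `1 / S`. On an
optimal path `T` is additive. Along gradient descent `T` decreases at rate one, and along
bidirectional descent at rate two, while the curves move at speed `S`, so that in time `t` they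
reach points at distance at most `t`. In each case both parts of the path have a smaller time than
the whole.
-/

namespace Eikonal

open MeasureTheory
open scoped NNReal

/-! ### Lipschitz curves and continuous induction -/

theorem intervalIntegrable_norm_deriv {d : ℕ} {η : ℝ → Conf d} {K : ℝ≥0} {a b : ℝ} (hab : a ≤ b)
    (h : LipschitzOnWith K η (Icc a b)) :
    IntervalIntegrable (fun t => ‖deriv η t‖) volume a b := by
  rw [intervalIntegrable_iff_integrableOn_Ioo_of_le hab]
  refine Measure.integrableOn_of_bounded (M := K) (by simp)
    (measurable_deriv η).norm.aestronglyMeasurable ?_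
  filter_upwards [ae_restrict_mem measurableSet_Ioo] with t ht
  simpa using norm_deriv_le_of_lipschitzOn (Icc_mem_nhds ht.1 ht.2) h

/-- The fundamental theorem of calculus, applied to the component of the curve in the direction of
`η b - η a`. -/
theorem norm_sub_le_integral_norm_deriv {d : ℕ} {η : ℝ → Conf d} {K : ℝ≥0} {a b : ℝ} (hab : a ≤ b)
    (h : LipschitzOnWith K η (Icc a b)) : ‖η b - η a‖ ≤ ∫ t in a..b, ‖deriv η t‖ := by
  set e : Conf d := η b - η a with he
  have hL : LipschitzOnWith (‖innerSL ℝ e‖₊ * K) (fun t => inner ℝ e (η t)) (uIcc a b) := by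
    rw [uIcc_of_le hab]
    exact (innerSL ℝ e).lipschitz.comp_lipschitzOnWith h
  have hAC := hL.absolutelyContinuousOnInterval
  have h1 := hAC.integral_deriv_eq_sub
  have h2 : ∫ t in a..b, deriv (fun t => inner ℝ e (η t)) t ≤ ∫ t in a..b, ‖e‖ * ‖deriv η t‖ := by
    refine intervalIntegral.integral_mono_ae_restrict hab hAC.intervalIntegrable_deriv
      ((intervalIntegrable_norm_deriv hab h).const_mul _) ?_
    rw [← restrict_Ioo_eq_restrict_Icc]
    have h3 := (h.mono Ioo_subset_Icc_self).ae_differentiableWithinAt_real measurableSet_Ioo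
    filter_upwards [h3, ae_restrict_mem measurableSet_Ioo] with t ht htm
    have hd : HasDerivAt η (deriv η t) t :=
      (ht.differentiableAt (Ioo_mem_nhds htm.1 htm.2)).hasDerivAt
    have : HasDerivAt (fun t => inner ℝ e (η t)) (inner ℝ e (deriv η t)) t := by
      simpa using (hasDerivAt_const t e).inner ℝ hd
    rw [this.deriv]
    exact real_inner_le_norm _ _
  rw [h1, ← inner_sub_right, ← he, real_inner_self_eq_norm_sq,
    intervalIntegral.integral_const_mul] at h2
  rcases (norm_nonneg e).eq_or_lt with h0 | h0
  · rw [← h0]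
    exact intervalIntegral.integral_nonneg hab fun t _ => norm_nonneg _
  · nlinarith

/-- Continuous induction: an increment bound that holds locally to the right of every point holds
on the whole interval. -/
theorem sub_le_integral_of_eventually {F g : ℝ → ℝ} {a b : ℝ} (hab : a ≤ b)
    (hF : ContinuousOn F (Icc a b)) (hg : IntervalIntegrable g volume a b)
    (hloc : ∀ t ∈ Ico a b, ∀ᶠ t' in 𝓝[>] t, F t' - F t ≤ ∫ x in t..t', g x) :
    F b - F a ≤ ∫ x in a..b, g x := by
  have hG : ContinuousOn (fun t => ∫ x in a..t, g x) (Icc a b) := by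
    have := intervalIntegral.continuousOn_primitive_interval' hg left_mem_uIcc
    rwa [uIcc_of_le hab] at this
  have hcl : IsClosed ({t | F t - F a ≤ ∫ x in a..t, g x} ∩ Icc a b) := by
    have hFG : ContinuousOn (fun t => F t - F a - ∫ x in a..t, g x) (Icc a b) :=
      (hF.sub continuousOn_const).sub hG
    have := hFG.preimage_isClosed_of_isClosed isClosed_Icc (isClosed_Iic (a := 0))
    convert this using 1
    ext t
    simp [and_comm]
  refine hcl.Icc_subset_of_forall_mem_nhdsWithin (by simp) ?_ (right_mem_Icc.2 hab)
  rintro t ⟨ht, hta⟩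
  have hb : ∀ᶠ t' in 𝓝[>] t, t' ≤ b :=
    mem_nhdsWithin_of_mem_nhds (Iic_mem_nhds hta.2)
  filter_upwards [hloc t hta, hb, self_mem_nhdsWithin] with t' h1 h2 h3
  have h3 : t < t' := h3
  have hsub : ∀ {p q : ℝ}, a ≤ p → p ≤ q → q ≤ b → IntervalIntegrable g volume p q := by
    intro p q h1 h2 h3
    refine hg.mono_set ?_
    rw [uIcc_of_le h2, uIcc_of_le hab]
    exact Icc_subset_Icc h1 h3
  have := intervalIntegral.integral_add_adjacent_intervals
    (hsub le_rfl hta.1 hta.2.le) (hsub hta.1 h3.le h2)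
  simp only [mem_ofPred_eq] at ht ⊢
  linarith

/-! ### Descent and growth rates of viscosity solutions -/

theorem gradient_const_mul_norm_sub_sq {d : ℕ} (α : ℝ) (y x : Conf d) :
    gradient (fun x => α * ‖x - y‖ ^ 2) x = (2 * α) • (x - y) := by
  have h1 : HasFDerivAt (fun x : Conf d => x - y) (ContinuousLinearMap.id ℝ (Conf d)) x :=
    (hasFDerivAt_id x).sub_const y
  have h2 := (h1.norm_sq).const_mul α
  refine HasGradientAt.gradient ?_
  rw [hasGradientAt_iff_hasFDerivAt]
  refine h2.congr_fderiv (ContinuousLinearMap.ext fun z => ?_)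
  simp [mul_assoc, mul_left_comm]

theorem contDiff_const_mul_norm_sub_sq {d : ℕ} (α : ℝ) (y : Conf d) :
    ContDiff ℝ ∞ (fun x => α * ‖x - y‖ ^ 2) :=
  contDiff_const.mul ((contDiff_id.sub contDiff_const).norm_sq ℝ)

namespace IsViscositySolutionFrom

variable {d : ℕ} {C : Set (Conf d)} {S : Conf d → ℝ} {s : Conf d} {u : Conf d → ℝ}

theorem two_mul_norm_le_of_localMax (hu : IsViscositySolutionFrom C S s u) {x₀ y : Conf d} {α : ℝ}
    (hx : x₀ ∈ interior C) (hs : x₀ ≠ s) (hα : 0 ≤ α)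
    (h : ∀ᶠ x in 𝓝 x₀, u x - α * ‖x - y‖ ^ 2 ≤ u x₀ - α * ‖x₀ - y‖ ^ 2) :
    2 * α * ‖x₀ - y‖ ≤ (S x₀)⁻¹ := by
  have := hu.sub _ (contDiff_const_mul_norm_sub_sq α y) x₀ hx hs (mem_nhdsWithin_of_mem_nhds h)
  rw [gradient_const_mul_norm_sub_sq, hamiltonian, norm_smul, Real.norm_of_nonneg (by positivity)]
    at this
  linarith

theorem le_two_mul_norm_of_localMin (hu : IsViscositySolutionFrom C S s u) {x₀ y : Conf d} {α : ℝ}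
    (hx : x₀ ∈ C) (hs : x₀ ≠ s) (hα : 0 ≤ α)
    (h : ∀ᶠ x in 𝓝[C] x₀, u x₀ + α * ‖x₀ - y‖ ^ 2 ≤ u x + α * ‖x - y‖ ^ 2) :
    (S x₀)⁻¹ ≤ 2 * α * ‖x₀ - y‖ := by
  have h' : IsLocalMinOn (fun x => u x - (-α) * ‖x - y‖ ^ 2) C x₀ := by
    filter_upwards [h] with x hx
    linarith
  have := hu.super _ (contDiff_const_mul_norm_sub_sq (-α) y) x₀ hx hs h'
  rw [gradient_const_mul_norm_sub_sq, hamiltonian, norm_smul, mul_neg, norm_neg,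
    Real.norm_of_nonneg (by positivity)] at this
  linarith

/-- A subsolution grows at rate at most `1 / S`. For fixed `y` the function
`x ↦ u x - k₁ ‖x - y‖ - A ‖x - y‖ ^ 2` with `A` large is maximal inside a small ball around `y`.
A maximum point `x₁ ≠ y` is excluded, as the norm is majorized by a quadratic function that
touches it along the sphere through `x₁`. -/
theorem eventually_sub_le (hu : IsViscositySolutionFrom C S s u) (hSc : ContinuousOn S C)
    (hSpos : ∀ x ∈ C, 0 < S x) {y : Conf d} (hy : y ∈ interior C) (hys : y ≠ s) {k : ℝ}
    (hk : (S y)⁻¹ < k) : ∀ᶠ x in 𝓝 y, u x - u y ≤ k * ‖x - y‖ := by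
  obtain ⟨k₁, hk₁, hk₁k⟩ := exists_between hk
  have hk₁pos : 0 < k₁ := (inv_pos.2 (hSpos y (interior_subset hy))).trans hk₁
  have hev : ∀ᶠ x in 𝓝 y, x ∈ interior C ∧ x ≠ s ∧ (S x)⁻¹ < k₁ := by
    have hc : ContinuousAt S y := hSc.continuousAt (mem_interior_iff_mem_nhds.1 hy)
    exact (isOpen_interior.eventually_mem hy).and ((eventually_ne_nhds hys).and
      ((hc.inv₀ (hSpos y (interior_subset hy)).ne').eventually_lt continuousAt_const hk₁))
  obtain ⟨ρ, hρ, hball⟩ := Metric.nhds_basis_closedBall.mem_iff.1 hev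
  have hcomp : IsCompact (Metric.closedBall y ρ) := isCompact_closedBall y ρ
  have hne : (Metric.closedBall y ρ).Nonempty := ⟨y, Metric.mem_closedBall_self hρ.le⟩
  have huc : ContinuousOn u (Metric.closedBall y ρ) :=
    hu.cont.mono fun x hx => interior_subset (hball hx).1
  obtain ⟨z, hz, hzmax⟩ := hcomp.exists_isMaxOn hne huc
  have hQ : 0 ≤ u z - u y := sub_nonneg.2 (hzmax (Metric.mem_closedBall_self hρ.le))
  set A : ℝ := (u z - u y + 1) / ρ ^ 2 with hA
  have hApos : 0 < A := by positivity
  have hAρ : A * ρ ^ 2 = u z - u y + 1 := by rw [hA]; field_simp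
  have hwc : ContinuousOn (fun x => u x - k₁ * ‖x - y‖ - A * ‖x - y‖ ^ 2)
      (Metric.closedBall y ρ) := by fun_prop
  obtain ⟨x₁, hx₁, hmax⟩ := hcomp.exists_isMaxOn hne hwc
  have hmax' : ∀ x ∈ Metric.closedBall y ρ, u x - k₁ * ‖x - y‖ - A * ‖x - y‖ ^ 2 ≤
      u x₁ - k₁ * ‖x₁ - y‖ - A * ‖x₁ - y‖ ^ 2 := fun x hx => hmax hx
  have hwy := hmax' y (Metric.mem_closedBall_self hρ.le)
  simp only [sub_self, norm_zero, mul_zero, ne_eq, OfNat.ofNat_ne_zero, not_false_eq_true,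
    zero_pow, sub_zero] at hwy
  have hx₁ρ : ‖x₁ - y‖ < ρ := by
    refine lt_of_le_of_ne (by simpa [dist_eq_norm] using hx₁) fun heq => ?_
    have h1 : u x₁ ≤ u z := hzmax hx₁
    have h2 := mul_pos hk₁pos hρ
    rw [heq, hAρ] at hwy
    linarith
  have hx₁y : x₁ = y := by
    by_contra hne
    have hn : 0 < ‖x₁ - y‖ := norm_pos_iff.2 (sub_ne_zero.2 hne)
    set n := ‖x₁ - y‖
    obtain ⟨hi, hs, hS⟩ := hball hx₁
    have hα : (0 : ℝ) ≤ k₁ / (2 * n) + A := by positivity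
    have := hu.two_mul_norm_le_of_localMax (y := y) hi hs hα ?_
    · have h2 : 2 * (k₁ / (2 * n) + A) * n = k₁ + 2 * A * n := by field_simp
      have h3 : 0 < 2 * A * n := by positivity
      have h4 : 2 * (k₁ / (2 * n) + A) * n ≤ (S x₁)⁻¹ := this
      linarith
    · have hmem : Metric.ball y ρ ∈ 𝓝 x₁ :=
        Metric.isOpen_ball.mem_nhds (by simpa [dist_eq_norm] using hx₁ρ)
      filter_upwards [hmem] with x hx
      have h1 := hmax' x (Metric.ball_subset_closedBall hx)
      -- the quadratic majorant `m ≤ m ^ 2 / (2 n) + n / 2` of the norm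
      have h2 : k₁ * ‖x - y‖ ≤ k₁ / (2 * n) * ‖x - y‖ ^ 2 + k₁ / (2 * n) * n ^ 2 := by
        have : k₁ / (2 * n) * ‖x - y‖ ^ 2 + k₁ / (2 * n) * n ^ 2 - k₁ * ‖x - y‖ =
            k₁ / (2 * n) * (‖x - y‖ - n) ^ 2 := by field_simp; ring
        have h3 : 0 ≤ k₁ / (2 * n) * (‖x - y‖ - n) ^ 2 := by positivity
        linarith
      have h3 : 2 * (k₁ / (2 * n) * n ^ 2) = k₁ * n := by field_simp
      have h4 : u x - k₁ * ‖x - y‖ - A * ‖x - y‖ ^ 2 ≤ u x₁ - k₁ * n - A * n ^ 2 := h1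
      change _ ≤ u x₁ - (k₁ / (2 * n) + A) * n ^ 2
      linarith
  have hsmall : ∀ᶠ x in 𝓝 y, A * ‖x - y‖ < k - k₁ := by
    have : ContinuousAt (fun x => A * ‖x - y‖) y := by fun_prop
    exact this.eventually_lt continuousAt_const (by simpa using hk₁k)
  filter_upwards [hsmall, Metric.closedBall_mem_nhds y hρ] with x hx hxρ
  have h1 := hmax' x hxρ
  rw [hx₁y] at h1
  simp only [sub_self, norm_zero, mul_zero, ne_eq, OfNat.ofNat_ne_zero, not_false_eq_true,
    zero_pow, sub_zero] at h1
  nlinarith [norm_nonneg (x - y)]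

/-- A supersolution descends at rate at least `1 / S` from every point of `C` but the source,
boundary points included. Otherwise
`y ↦ u y + k √(‖y - x‖ ^ 2 + δ ^ 2) + c ‖y - x‖ ^ 2` has, for small `δ`, a local minimum near
`x`, and the square root, a concave function of `‖y - x‖ ^ 2`, lies below a quadratic function
that touches it there. -/
theorem exists_descent (hu : IsViscositySolutionFrom C S s u) (hC : IsClosed C)
    (hSc : ContinuousOn S C) (hSpos : ∀ x ∈ C, 0 < S x) {x : Conf d} (hx : x ∈ C) (hxs : x ≠ s)
    {k r : ℝ} (hk0 : 0 ≤ k) (hk : k < (S x)⁻¹) (hr : 0 < r) :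
    ∃ y ∈ C, ‖y - x‖ < r ∧ u y < u x - k * ‖y - x‖ := by
  by_contra! hcon
  obtain ⟨k₁, hkk₁, hk₁⟩ := exists_between hk
  have hev : ∀ᶠ y in 𝓝[C] x, y ≠ s ∧ k₁ < (S y)⁻¹ := by
    exact ((eventually_ne_nhds hxs).filter_mono nhdsWithin_le_nhds).and
      (((hSc x hx).inv₀ (hSpos x hx).ne').eventually (lt_mem_nhds hk₁))
  obtain ⟨ρ₀, hρ₀, hball₀⟩ := (nhdsWithin_hasBasis Metric.nhds_basis_closedBall C).mem_iff.1 hev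
  obtain ⟨ρ, hρ, hρ'⟩ := exists_between (lt_min hρ₀ hr)
  have hρr : ρ < r := hρ'.trans_le (min_le_right _ _)
  have hball : ∀ y ∈ Metric.closedBall x ρ ∩ C, y ≠ s ∧ k₁ < (S y)⁻¹ := fun y hy =>
    hball₀ ⟨Metric.closedBall_subset_closedBall (hρ'.trans_le (min_le_left _ _)).le hy.1, hy.2⟩
  set c : ℝ := (k₁ - k) / (2 * ρ) with hc
  have hcpos : 0 < c := div_pos (sub_pos.2 hkk₁) (by positivity)
  have hcρ : 2 * c * ρ = k₁ - k := by rw [hc]; field_simp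
  set δ : ℝ := c * ρ ^ 2 / (k + 1) with hδ
  have hδpos : 0 < δ := by positivity
  have hkδ : k * δ < c * ρ ^ 2 := by
    have : (k + 1) * δ = c * ρ ^ 2 := by rw [hδ]; field_simp
    linarith
  have hcomp : IsCompact (Metric.closedBall x ρ ∩ C) := (isCompact_closedBall x ρ).inter_right hC
  have hxmem : x ∈ Metric.closedBall x ρ ∩ C := ⟨Metric.mem_closedBall_self hρ.le, hx⟩
  have huc : ContinuousOn u (Metric.closedBall x ρ ∩ C) := hu.cont.mono inter_subset_right
  have hψc : ContinuousOn (fun y => u y + k * √(‖y - x‖ ^ 2 + δ ^ 2) + c * ‖y - x‖ ^ 2)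
      (Metric.closedBall x ρ ∩ C) := by fun_prop
  obtain ⟨y₁, hy₁, hmin⟩ := hcomp.exists_isMinOn ⟨x, hxmem⟩ hψc
  have hmin' : ∀ y ∈ Metric.closedBall x ρ ∩ C,
      u y₁ + k * √(‖y₁ - x‖ ^ 2 + δ ^ 2) + c * ‖y₁ - x‖ ^ 2 ≤
      u y + k * √(‖y - x‖ ^ 2 + δ ^ 2) + c * ‖y - x‖ ^ 2 := fun y hy => hmin hy
  set n := ‖y₁ - x‖ with hn
  have hn0 : 0 ≤ n := norm_nonneg _
  set σ := √(n ^ 2 + δ ^ 2) with hσ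
  have hσpos : 0 < σ := Real.sqrt_pos.2 (by positivity)
  have hσsq : σ ^ 2 = n ^ 2 + δ ^ 2 := Real.sq_sqrt (by positivity)
  have hnσ : n ≤ σ := Real.le_sqrt_of_sq_le (by nlinarith)
  have hnρle : n ≤ ρ := by simpa [dist_eq_norm] using hy₁.1
  have hnρ : n < ρ := by
    have h1 := hmin' x hxmem
    simp only [sub_self, norm_zero, ne_eq, OfNat.ofNat_ne_zero, not_false_eq_true, zero_pow,
      zero_add, mul_zero, add_zero, Real.sqrt_sq hδpos.le] at h1
    have h2 := hcon y₁ hy₁.2 (hnρle.trans_lt hρr)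
    have h3 := mul_le_mul_of_nonneg_left hnσ hk0
    have h4 : c * n ^ 2 < c * ρ ^ 2 := by linarith
    exact lt_of_pow_lt_pow_left₀ 2 hρ.le (lt_of_mul_lt_mul_left h4 hcpos.le)
  have hα : 0 ≤ k / (2 * σ) + c := by positivity
  obtain ⟨hys, hyS⟩ := hball y₁ hy₁
  have := hu.le_two_mul_norm_of_localMin (y := x) hy₁.2 hys hα ?_
  · have h1 : 2 * (k / (2 * σ) + c) * n = k * (n / σ) + 2 * c * n := by field_simp
    have h2 : k * (n / σ) ≤ k * 1 :=
      mul_le_mul_of_nonneg_left ((div_le_one hσpos).2 hnσ) hk0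
    have h3 : 2 * c * n ≤ 2 * c * ρ := by gcongr
    have h4 : (S y₁)⁻¹ ≤ 2 * (k / (2 * σ) + c) * n := this
    linarith
  · have hmem : Metric.ball x ρ ∈ 𝓝 y₁ :=
      Metric.isOpen_ball.mem_nhds (by simpa [dist_eq_norm] using hnρ)
    filter_upwards [mem_nhdsWithin_of_mem_nhds hmem, self_mem_nhdsWithin] with y hy hyC
    have h1 := hmin' y ⟨Metric.ball_subset_closedBall hy, hyC⟩
    set τ := √(‖y - x‖ ^ 2 + δ ^ 2) with hτ
    have hτsq : τ ^ 2 = ‖y - x‖ ^ 2 + δ ^ 2 := Real.sq_sqrt (by positivity)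
    -- the tangent line of the square root lies above it
    have h2 : k * τ - k * σ ≤ k / (2 * σ) * (‖y - x‖ ^ 2 - n ^ 2) := by
      have h3 : k / (2 * σ) * (‖y - x‖ ^ 2 - n ^ 2) - (k * τ - k * σ) =
          k / (2 * σ) * (τ - σ) ^ 2 := by
        have : ‖y - x‖ ^ 2 - n ^ 2 = τ ^ 2 - σ ^ 2 := by rw [hτsq, hσsq]; ring
        rw [this]
        field_simp
        ring
      have h4 : 0 ≤ k / (2 * σ) * (τ - σ) ^ 2 := by positivity
      linarith
    change u y₁ + (k / (2 * σ) + c) * n ^ 2 ≤ _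
    linarith

/-- The solution has no zero besides the source, since it descends from every other point. -/
theorem pos (hu : IsViscositySolutionFrom C S s u) (hC : IsClosed C)
    (hSc : ContinuousOn S C) (hSpos : ∀ x ∈ C, 0 < S x) {x : Conf d} (hx : x ∈ C) (hxs : x ≠ s) :
    0 < u x := by
  obtain ⟨y, hy, -, h⟩ := hu.exists_descent hC hSc hSpos hx hxs le_rfl
    (inv_pos.2 (hSpos x hx)) one_pos
  have := hu.nonneg y hy
  linarith

/-- The equation holds at points of differentiability. A function that is merely differentiable
need not be touched by smooth functions there, so the gradient is compared with the rates of growth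
and descent instead. -/
theorem norm_gradient_eq (hu : IsViscositySolutionFrom C S s u) (hC : IsClosed C)
    (hSc : ContinuousOn S C) (hSpos : ∀ x ∈ C, 0 < S x) {x : Conf d} (hx : x ∈ interior C)
    (hxs : x ≠ s) (hd : DifferentiableAt ℝ u x) : ‖gradient u x‖ = (S x)⁻¹ := by
  set g := gradient u x with hg
  have hlo := hasGradientAt_iff_isLittleO.1 hd.hasGradientAt
  apply le_antisymm
  · rcases eq_or_ne g 0 with h0 | h0
    · rw [h0, norm_zero]
      exact (inv_pos.2 (hSpos x (interior_subset hx))).le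
    have hgpos := norm_pos_iff.2 h0
    refine le_of_forall_gt_imp_ge_of_dense fun k hk => ?_
    refine le_of_forall_pos_le_add fun ε hε => ?_
    have h1 := hu.eventually_sub_le hSc hSpos hx hxs hk
    have hline : Tendsto (fun t : ℝ => x + t • g) (𝓝[>] 0) (𝓝 x) := by
      have : Continuous (fun t : ℝ => x + t • g) := by fun_prop
      simpa using (this.tendsto 0).mono_left nhdsWithin_le_nhds
    obtain ⟨t, ⟨h3, h4⟩, ht⟩ :=
      ((hline.eventually (h1.and (hlo.bound hε))).and self_mem_nhdsWithin).exists
    have ht : 0 < t := ht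
    rw [← hg] at h4
    simp only [add_sub_cancel_left, inner_smul_right, real_inner_self_eq_norm_sq, norm_smul,
      Real.norm_eq_abs, abs_of_pos ht] at h3 h4
    have h5 := (abs_le.1 h4).1
    have h6 : (t * ‖g‖) * ‖g‖ ≤ (t * ‖g‖) * (k + ε) := by nlinarith
    exact le_of_mul_le_mul_left h6 (by positivity)
  · refine le_of_forall_lt_imp_le_of_dense fun k hk => ?_
    rcases lt_or_ge k 0 with hk0 | hk0
    · exact hk0.le.trans (norm_nonneg _)
    refine le_of_forall_pos_le_add fun ε hε => ?_
    obtain ⟨r, hr, hball⟩ := Metric.nhds_basis_ball.mem_iff.1 (hlo.bound hε)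
    obtain ⟨y, -, hyr, hy⟩ := hu.exists_descent hC hSc hSpos (interior_subset hx) hxs hk0 hk hr
    have h4 := hball (show y ∈ Metric.ball x r by simpa [dist_eq_norm] using hyr)
    simp only [mem_ofPred_eq, ← hg, Real.norm_eq_abs] at h4
    have h5 := (abs_le.1 h4).1
    have h6 := (abs_le.1 (abs_real_inner_le_norm g (y - x))).1
    have hpos : 0 < ‖y - x‖ := by
      refine norm_pos_iff.2 (sub_ne_zero.2 ?_)
      rintro rfl
      simp at hy
    have h7 : ‖y - x‖ * k ≤ ‖y - x‖ * (‖g‖ + ε) := by nlinarith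
    exact le_of_mul_le_mul_left h7 hpos

end IsViscositySolutionFrom

/-! ### Upper bound by the travel time -/

/-- A set with Lipschitz boundary can be pushed into its interior near each of its points, by a
translation in a fixed direction (which is zero at interior points). -/
theorem HasLipschitzBoundary.exists_add_smul_mem_interior {d : ℕ} {C : Set (Conf d)}
    (hb : HasLipschitzBoundary C) {x₀ : Conf d} (hx₀ : x₀ ∈ C) :
    ∃ e : Conf d, ∃ ε > 0, ∀ x ∈ C ∩ Metric.ball x₀ ε, ∀ t ∈ Ioo (0 : ℝ) ε,
      x + t • e ∈ interior C := by
  by_cases hi : x₀ ∈ interior C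
  · obtain ⟨ε, hε, hball⟩ := Metric.isOpen_iff.1 isOpen_interior x₀ hi
    exact ⟨0, ε, hε, fun x hx t _ => by simpa using hball hx.2⟩
  · obtain ⟨e, ε, hε, h⟩ := hb x₀ ⟨subset_closure hx₀, hi⟩
    refine ⟨e, ε, hε, fun x hx t ht => mem_interior.2 ⟨_, h x hx t ht, Metric.isOpen_ball, ?_⟩⟩
    exact Metric.mem_ball_self (mul_pos hε ht.1)

/-- The integrand of the travel time is integrable along Lipschitz curves in `C`. -/
theorem intervalIntegrable_norm_deriv_div {d : ℕ} {C : Set (Conf d)} {S : Conf d → ℝ}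
    (hSc : ContinuousOn S C) (hSpos : ∀ x ∈ C, 0 < S x) {η : ℝ → Conf d} {K : ℝ≥0} {a b : ℝ}
    (hab : a ≤ b) (hη : LipschitzOnWith K η (Icc a b)) (hC : MapsTo η (Icc a b) C) :
    IntervalIntegrable (fun t => ‖deriv η t‖ / S (η t)) volume a b := by
  simp only [div_eq_mul_inv]
  refine (intervalIntegrable_norm_deriv hab hη).mul_continuousOn ?_
  rw [uIcc_of_le hab]
  exact (hSc.comp hη.continuousOn hC).inv₀ fun t ht => (hSpos _ (hC ht)).ne'

namespace IsViscositySolutionFrom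

variable {d : ℕ} {C : Set (Conf d)} {S : Conf d → ℝ} {s : Conf d} {u : Conf d → ℝ}

theorem sub_le_integral_of_mem_interior (hu : IsViscositySolutionFrom C S s u)
    (hSc : ContinuousOn S C) (hSpos : ∀ x ∈ C, 0 < S x) {η : ℝ → Conf d} {K : ℝ≥0} {a b k : ℝ}
    (hab : a ≤ b) (hη : LipschitzOnWith K η (Icc a b))
    (hint : ∀ t ∈ Icc a b, η t ∈ interior C ∧ η t ≠ s ∧ (S (η t))⁻¹ < k) :
    u (η b) - u (η a) ≤ ∫ t in a..b, k * ‖deriv η t‖ := by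
  refine sub_le_integral_of_eventually (F := fun t => u (η t)) hab
    (hu.cont.comp hη.continuousOn fun t ht => interior_subset (hint t ht).1)
    ((intervalIntegrable_norm_deriv hab hη).const_mul k) fun t ht => ?_
  obtain ⟨hti, hts, htk⟩ := hint t (Ico_subset_Icc_self ht)
  have hk : 0 ≤ k := ((inv_pos.2 (hSpos _ (interior_subset hti))).trans htk).le
  have hcont : Tendsto η (𝓝[>] t) (𝓝 (η t)) :=
    (hη.continuousOn t (Ico_subset_Icc_self ht)).mono_left
      (nhdsWithin_le_of_mem (Icc_mem_nhdsGT_of_mem ht))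
  filter_upwards [hcont.eventually (hu.eventually_sub_le hSc hSpos hti hts htk),
    Icc_mem_nhdsGT_of_mem ht, self_mem_nhdsWithin] with t' h1 h2 h3
  have h3 : t < t' := h3
  have h4 := norm_sub_le_integral_norm_deriv h3.le (hη.mono (Icc_subset_Icc ht.1 h2.2))
  rw [intervalIntegral.integral_const_mul]
  exact h1.trans (mul_le_mul_of_nonneg_left h4 hk)

/-- Near a point of `C`, boundary points included, a subsolution grows along curves in `C` at a
rate close to `1 / S`: the curve is shifted into the interior of `C`, which does not change its
derivative. -/
theorem exists_forall_sub_le_integral (hu : IsViscositySolutionFrom C S s u)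
    (hb : HasLipschitzBoundary C)
    (hSc : ContinuousOn S C) (hSpos : ∀ x ∈ C, 0 < S x) {x₀ : Conf d} (hx₀ : x₀ ∈ C)
    (hx₀s : x₀ ≠ s) {k : ℝ} (hk : (S x₀)⁻¹ < k) :
    ∃ ρ > 0, ∀ (η : ℝ → Conf d) (K : ℝ≥0) (a b : ℝ), a ≤ b → LipschitzOnWith K η (Icc a b) →
      (∀ t ∈ Icc a b, η t ∈ C ∩ Metric.ball x₀ ρ) →
      u (η b) - u (η a) ≤ ∫ t in a..b, k * ‖deriv η t‖ := by
  have hev : ∀ᶠ x in 𝓝[C] x₀, x ≠ s ∧ (S x)⁻¹ < k :=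
    ((eventually_ne_nhds hx₀s).filter_mono nhdsWithin_le_nhds).and
      (((hSc x₀ hx₀).inv₀ (hSpos x₀ hx₀).ne').eventually (gt_mem_nhds hk))
  obtain ⟨ρ₁, hρ₁, hball⟩ := (nhdsWithin_hasBasis Metric.nhds_basis_ball C).mem_iff.1 hev
  obtain ⟨e, ε, hε, hcone⟩ := hb.exists_add_smul_mem_interior hx₀
  refine ⟨min (ρ₁ / 2) ε, by positivity, fun η K a b hab hη hmem => ?_⟩
  have hshift : ∀ᶠ h : ℝ in 𝓝[>] 0, ∀ t ∈ Icc a b, η t + h • e ∈ interior C ∧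
      η t + h • e ≠ s ∧ (S (η t + h • e))⁻¹ < k := by
    have hsmall : ∀ᶠ h : ℝ in 𝓝[>] 0, ‖h • e‖ < ρ₁ / 2 := by
      have : ContinuousAt (fun h : ℝ => ‖h • e‖) 0 := by fun_prop
      exact (this.eventually_lt continuousAt_const (by simpa using half_pos hρ₁)).filter_mono
        nhdsWithin_le_nhds
    filter_upwards [hsmall, Ioo_mem_nhdsGT hε] with h h1 h2 t ht
    obtain ⟨htC, htb⟩ := hmem t ht
    have hi : η t + h • e ∈ interior C :=
      hcone _ ⟨htC, Metric.ball_subset_ball (min_le_right _ _) htb⟩ h h2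
    refine ⟨hi, hball ⟨?_, interior_subset hi⟩⟩
    have h3 : dist (η t) x₀ < ρ₁ / 2 := Metric.ball_subset_ball (min_le_left _ _) htb
    have h4 : dist (η t + h • e) (η t) < ρ₁ / 2 := by simpa [dist_eq_norm] using h1
    have := dist_triangle (η t + h • e) (η t) x₀
    rw [Metric.mem_ball]
    linarith
  have hlim : ∀ t ∈ Icc a b, Tendsto (fun h : ℝ => u (η t + h • e)) (𝓝[>] 0) (𝓝 (u (η t))) := by
    intro t ht
    refine (hu.cont (η t) (hmem t ht).1).tendsto.comp (tendsto_nhdsWithin_iff.2 ⟨?_, ?_⟩)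
    · have : Continuous (fun h : ℝ => η t + h • e) := by fun_prop
      simpa using (this.tendsto 0).mono_left nhdsWithin_le_nhds
    · filter_upwards [hshift] with h hh
      exact interior_subset (hh t ht).1
  refine le_of_tendsto ((hlim b (right_mem_Icc.2 hab)).sub (hlim a (left_mem_Icc.2 hab))) ?_
  filter_upwards [hshift] with h hh
  have hη' : LipschitzOnWith K (fun t => η t + h • e) (Icc a b) := fun x hx y hy => by
    simpa using hη hx hy
  simpa using hu.sub_le_integral_of_mem_interior hSc hSpos hab hη' hh

/-- The bound by the travel time for curves that avoid the source: by continuous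
induction it holds with `1 / S + ε` in place of `1 / S`, since `S` is continuous along the curve. -/
theorem sub_le_integral_of_ne_source (hu : IsViscositySolutionFrom C S s u)
    (hb : HasLipschitzBoundary C)
    (hSc : ContinuousOn S C) (hSpos : ∀ x ∈ C, 0 < S x) {η : ℝ → Conf d} {K : ℝ≥0} {a b : ℝ}
    (hab : a ≤ b) (hη : LipschitzOnWith K η (Icc a b)) (hC : MapsTo η (Icc a b) C)
    (hs : ∀ t ∈ Icc a b, η t ≠ s) :
    u (η b) - u (η a) ≤ ∫ t in a..b, ‖deriv η t‖ / S (η t) := by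
  have hI := intervalIntegrable_norm_deriv_div hSc hSpos hab hη hC
  have hN := intervalIntegrable_norm_deriv hab hη
  have key : ∀ ε > 0, u (η b) - u (η a) ≤
      ∫ t in a..b, (‖deriv η t‖ / S (η t) + ε * ‖deriv η t‖) := by
    intro ε hε
    refine sub_le_integral_of_eventually (F := fun t => u (η t)) hab
      (hu.cont.comp hη.continuousOn hC) (hI.add (hN.const_mul ε)) fun t ht => ?_
    have htI := Ico_subset_Icc_self ht
    obtain ⟨ρ, hρ, hloc⟩ := hu.exists_forall_sub_le_integral hb hSc hSpos (hC htI) (hs t htI)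
      (k := (S (η t))⁻¹ + ε / 2) (by linarith)
    have hle : 𝓝[≥] t ≤ 𝓝[Icc a b] t := nhdsWithin_le_of_mem (Icc_mem_nhdsGE_of_mem ht)
    have hcont := (hη.continuousOn t htI).mono_left hle
    have hcontS := (((hSc.comp hη.continuousOn hC).inv₀
      fun t ht => (hSpos _ (hC ht)).ne') t htI).mono_left hle
    have hev : ∀ᶠ x in 𝓝[≥] t, x ∈ Icc a b ∧ η x ∈ Metric.ball (η t) ρ ∧
        (S (η t))⁻¹ - ε / 2 < (S (η x))⁻¹ :=
      (show ∀ᶠ x in 𝓝[≥] t, x ∈ Icc a b from Icc_mem_nhdsGE_of_mem ht).and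
        ((hcont.eventually (Metric.ball_mem_nhds _ hρ)).and
          (hcontS.eventually (lt_mem_nhds (by simpa using hε))))
    obtain ⟨v, hv, hsub⟩ := mem_nhdsGE_iff_exists_Icc_subset.1 hev
    filter_upwards [Ioo_mem_nhdsGT hv] with t' ht'
    have hIcc : Icc t t' ⊆ Icc t v := Icc_subset_Icc_right ht'.2.le
    have hsub' : Icc t t' ⊆ Icc a b := fun x hx => (hsub (hIcc hx)).1
    have hη' := hη.mono hsub'
    refine (hloc η K t t' ht'.1.le hη' fun x hx =>
      ⟨hC (hsub' hx), (hsub (hIcc hx)).2.1⟩).trans ?_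
    have hN' := intervalIntegrable_norm_deriv ht'.1.le hη'
    refine intervalIntegral.integral_mono_on ht'.1.le (hN'.const_mul _)
      ((intervalIntegrable_norm_deriv_div hSc hSpos ht'.1.le hη' (hC.mono_left hsub')).add
        (hN'.const_mul ε)) fun x hx => ?_
    have h1 := (hsub (hIcc hx)).2.2
    have h2 : ‖deriv η x‖ / S (η x) = ‖deriv η x‖ * (S (η x))⁻¹ := div_eq_mul_inv _ _
    nlinarith [norm_nonneg (deriv η x)]
  set I := ∫ t in a..b, ‖deriv η t‖ with hIdef
  have hI0 : 0 ≤ I := intervalIntegral.integral_nonneg hab fun t _ => norm_nonneg _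
  refine le_of_forall_pos_le_add fun ε hε => ?_
  have := key (ε / (I + 1)) (by positivity)
  rw [intervalIntegral.integral_add hI (hN.const_mul _), intervalIntegral.integral_const_mul,
    ← hIdef] at this
  have h2 : ε / (I + 1) * I ≤ ε := by
    rw [div_mul_eq_mul_div, div_le_iff₀ (by positivity)]
    nlinarith
  linarith

/-- A viscosity solution grows along a Lipschitz curve in `C` by at most the travel time. The
equation fails at the source, but there the solution vanishes, so that only the part of the curve
after its last visit to the source matters. -/
theorem le_add_integral (hu : IsViscositySolutionFrom C S s u) (hb : HasLipschitzBoundary C)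
    (hSc : ContinuousOn S C) (hSpos : ∀ x ∈ C, 0 < S x) {η : ℝ → Conf d} {K : ℝ≥0} {a b : ℝ}
    (hab : a ≤ b) (hη : LipschitzOnWith K η (Icc a b)) (hC : MapsTo η (Icc a b) C) :
    u (η b) ≤ u (η a) + ∫ t in a..b, ‖deriv η t‖ / S (η t) := by
  have hI := intervalIntegrable_norm_deriv_div hSc hSpos hab hη hC
  have hnn : ∀ t ∈ Icc a b, 0 ≤ ‖deriv η t‖ / S (η t) := fun t ht =>
    div_nonneg (norm_nonneg _) (hSpos _ (hC ht)).le
  have hua := hu.nonneg _ (hC (left_mem_Icc.2 hab))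
  by_cases hs : ∀ t ∈ Icc a b, η t ≠ s
  · linarith [hu.sub_le_integral_of_ne_source hb hSc hSpos hab hη hC hs]
  push Not at hs
  obtain ⟨t₀, ht₀, hst₀⟩ := hs
  have hcl : IsClosed (Icc a b ∩ η ⁻¹' {s}) :=
    hη.continuousOn.preimage_isClosed_of_isClosed isClosed_Icc isClosed_singleton
  have hcpt : IsCompact (Icc a b ∩ η ⁻¹' {s}) :=
    isCompact_Icc.of_isClosed_subset hcl inter_subset_left
  obtain ⟨c, ⟨hc, hcs⟩, hmax⟩ := hcpt.exists_isGreatest ⟨t₀, ht₀, hst₀⟩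
  have hcs : η c = s := hcs
  rcases hc.2.eq_or_lt with rfl | hcb
  · have := intervalIntegral.integral_nonneg (μ := volume) hab hnn
    rw [hcs, hu.source]
    linarith
  have hprim : ContinuousOn (fun t => ∫ x in a..t, ‖deriv η x‖ / S (η x)) (Icc a b) := by
    have := intervalIntegral.continuousOn_primitive_interval' hI left_mem_uIcc
    rwa [uIcc_of_le hab] at this
  have hF : ContinuousOn (fun t => u (η t) - ∫ x in a..t, ‖deriv η x‖ / S (η x)) (Icc a b) :=
    (hu.cont.comp hη.continuousOn hC).sub hprim
  have hlim := (hF c hc).mono_left (nhdsWithin_le_of_mem (Icc_mem_nhdsGT_of_mem ⟨hc.1, hcb⟩))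
  have hle : u (η b) - ∫ x in a..b, ‖deriv η x‖ / S (η x) ≤
      u (η c) - ∫ x in a..c, ‖deriv η x‖ / S (η x) := by
    refine ge_of_tendsto hlim ?_
    filter_upwards [Ioo_mem_nhdsGT hcb] with t ht
    have hsub : Icc t b ⊆ Icc a b := Icc_subset_Icc_left (hc.1.trans ht.1.le)
    have hsub' : Icc a t ⊆ Icc a b := Icc_subset_Icc_right ht.2.le
    have h1 := hu.sub_le_integral_of_ne_source hb hSc hSpos ht.2.le (hη.mono hsub)
      (hC.mono_left hsub) fun x hx hxs => (ht.1.trans_le hx.1).not_ge (hmax ⟨hsub hx, hxs⟩)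
    have h2 := intervalIntegral.integral_add_adjacent_intervals
      (intervalIntegrable_norm_deriv_div hSc hSpos (hc.1.trans ht.1.le) (hη.mono hsub')
        (hC.mono_left hsub'))
      (intervalIntegrable_norm_deriv_div hSc hSpos ht.2.le (hη.mono hsub) (hC.mono_left hsub))
    linarith
  have h3 : 0 ≤ ∫ x in a..c, ‖deriv η x‖ / S (η x) :=
    intervalIntegral.integral_nonneg hc.1 fun t ht => hnn t (Icc_subset_Icc_right hc.2 ht)
  rw [hcs, hu.source] at hle
  linarith

/-- A curve in `C` that respects the speed limit `S` needs the time by which it is parametrized. -/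
theorem le_add_sub (hu : IsViscositySolutionFrom C S s u) (hb : HasLipschitzBoundary C)
    (hSc : ContinuousOn S C) (hSpos : ∀ x ∈ C, 0 < S x) {η : ℝ → Conf d} {K : ℝ≥0} {a b : ℝ}
    (hab : a ≤ b) (hη : LipschitzOnWith K η (Icc a b)) (hC : MapsTo η (Icc a b) C)
    (hspeed : ∀ t ∈ Ioo a b, ‖deriv η t‖ ≤ S (η t)) :
    u (η b) ≤ u (η a) + (b - a) := by
  have h1 := hu.le_add_integral hb hSc hSpos hab hη hC
  have h2 : ∫ t in a..b, ‖deriv η t‖ / S (η t) ≤ ∫ _ in a..b, (1 : ℝ) :=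
    intervalIntegral.integral_mono_on_of_le_Ioo hab
      (intervalIntegrable_norm_deriv_div hSc hSpos hab hη hC) intervalIntegrable_const
      fun t ht => div_le_one_of_le₀ (hspeed t ht) (hSpos _ (hC (Ioo_subset_Icc_self ht))).le
  simp only [intervalIntegral.integral_const, smul_eq_mul, mul_one] at h2
  linarith

end IsViscositySolutionFrom

/-! ### Curves that attain the time -/

/-- A jump inside `C`, of length less than `r`, along which `u` drops at the rate `1 / (S x + r)`
at least. -/
def IsDescentStep {d : ℕ} (C : Set (Conf d)) (S : Conf d → ℝ) (u : Conf d → ℝ) (r : ℝ)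
    (x y : Conf d) : Prop :=
  y ∈ C ∧ ‖y - x‖ < r ∧ ‖y - x‖ ≤ (S x + r) * (u x - u y)

section

variable {d : ℕ} {C : Set (Conf d)} {S : Conf d → ℝ} {s : Conf d} {u : Conf d → ℝ}

/-- A chain of descent steps from `g` to `y`, as a step function parametrized by the drop of `u`.
It waits in `g` before time zero and in `y` in the end, and it respects the speed limit up to
errors `r`. -/
theorem exists_stepFunction_of_reflTransGen (hSpos : ∀ x ∈ C, 0 < S x) {r : ℝ} (hr : 0 < r)
    {g y : Conf d} (hg : g ∈ C) (hy : Relation.ReflTransGen (IsDescentStep C S u r) g y) :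
    u y ≤ u g ∧ y ∈ C ∧ ∃ γ : ℝ → Conf d, (∀ t, γ t ∈ C) ∧ (∀ t < 0, γ t = g) ∧
      (∀ t, u g - u y ≤ t → γ t = y) ∧
      ∀ t t', t ≤ t' → ∀ σ, (∀ x ∈ Icc t t', S (γ x) + r ≤ σ) →
        ‖γ t' - γ t‖ ≤ σ * (t' - t) + r := by
  induction hy with
  | refl =>
    refine ⟨le_rfl, hg, fun _ => g, fun _ => hg, fun _ _ => rfl, fun _ _ => rfl, ?_⟩
    intro t t' htt' σ hσ
    have h1 := hσ t (left_mem_Icc.2 htt')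
    have h2 := hSpos g hg
    have h3 : 0 ≤ σ * (t' - t) := mul_nonneg (by linarith) (by linarith)
    simp only [sub_self, norm_zero]
    linarith
  | @tail y z _ hstep ih =>
    obtain ⟨hyg, hyC, γ, hγC, hγ0, hγy, hγ⟩ := ih
    obtain ⟨hzC, hzr, hz⟩ := hstep
    have hSy := hSpos y hyC
    have hdrop : u z ≤ u y := by
      have : 0 ≤ (S y + r) * (u y - u z) := (norm_nonneg _).trans hz
      have := nonneg_of_mul_nonneg_right this (by linarith)
      linarith
    rcases hdrop.eq_or_lt with heq | hlt
    · -- a step without drop does not move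
      have hzy : z = y := by
        rw [heq, sub_self, mul_zero] at hz
        exact sub_eq_zero.1 (norm_le_zero_iff.1 hz)
      rw [hzy]
      exact ⟨hyg, hyC, γ, hγC, hγ0, hγy, hγ⟩
    obtain ⟨γ', hγ'lt, hγ'ge⟩ : ∃ γ' : ℝ → Conf d, (∀ t < u g - u z, γ' t = γ t) ∧
        ∀ t, u g - u z ≤ t → γ' t = z :=
      ⟨fun t => if t < u g - u z then γ t else z, fun t ht => if_pos ht,
        fun t ht => if_neg ht.not_gt⟩
    have hγ'C : ∀ t, γ' t ∈ C := fun t => by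
      rcases lt_or_ge t (u g - u z) with h | h
      · exact hγ'lt t h ▸ hγC t
      · exact (hγ'ge t h).symm ▸ hzC
    refine ⟨hdrop.trans hyg, hzC, γ', hγ'C, fun t ht => ?_, hγ'ge, fun t t' htt' σ hσ => ?_⟩
    · rw [hγ'lt t (by linarith), hγ0 t ht]
    have hσ0 : 0 ≤ σ := by
      have := hσ t (left_mem_Icc.2 htt')
      linarith [hSpos _ (hγ'C t)]
    have hσt : 0 ≤ σ * (t' - t) := mul_nonneg hσ0 (by linarith)
    rcases lt_or_ge t' (u g - u z) with h1 | h1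
    · rw [hγ'lt t' h1, hγ'lt t (by linarith)]
      refine hγ t t' htt' σ fun x hx => ?_
      rw [← hγ'lt x (hx.2.trans_lt h1)]
      exact hσ x hx
    rw [hγ'ge t' h1]
    rcases lt_or_ge t (u g - u z) with h2 | h2
    swap
    · rw [hγ'ge t h2, sub_self, norm_zero]
      linarith
    rw [hγ'lt t h2]
    rcases le_or_gt (u g - u y) t with h5 | h5
    · rw [hγy t h5]
      linarith
    have h6 := hγ t (u g - u y) h5.le σ fun x hx => by
      rw [← hγ'lt x (by linarith [hx.2])]
      exact hσ x ⟨hx.1, by linarith [hx.2]⟩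
    have h7 := hσ (u g - u y) ⟨h5.le, by linarith⟩
    rw [hγ'lt _ (by linarith), hγy _ le_rfl] at h7
    rw [hγy _ le_rfl] at h6
    have h8 : (S y + r) * (u y - u z) ≤ σ * (u y - u z) :=
      mul_le_mul_of_nonneg_right h7 (by linarith)
    have h9 : σ * (u g - u z - t) ≤ σ * (t' - t) :=
      mul_le_mul_of_nonneg_left (by linarith) hσ0
    have h10 : ‖z - γ t‖ ≤ ‖z - y‖ + ‖y - γ t‖ := norm_sub_le_norm_sub_add_norm_sub _ _ _
    linarith

namespace IsViscositySolutionFrom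

/-- Chains of descent steps come arbitrarily close to the source: on the compact closure of the
set of points they reach, `u` attains its minimum, and no step is possible from a minimum. -/
theorem exists_reflTransGen_norm_sub_lt (hu : IsViscositySolutionFrom C S s u) (hC : IsClosed C)
    (hSc : ContinuousOn S C) (hSpos : ∀ x ∈ C, 0 < S x) {M : ℝ} (hM : ∀ x ∈ C, S x ≤ M)
    {g : Conf d} (hg : g ∈ C) {r : ℝ} (hr : 0 < r) :
    ∃ y, Relation.ReflTransGen (IsDescentStep C S u r) g y ∧ ‖y - s‖ < r := by
  set R : Set (Conf d) := {y | Relation.ReflTransGen (IsDescentStep C S u r) g y} with hR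
  have hRC : R ⊆ C := fun y hy => (exists_stepFunction_of_reflTransGen hSpos hr hg hy).2.1
  have hM0 : 0 < M := (hSpos g hg).trans_le (hM g hg)
  have hbdd : R ⊆ Metric.closedBall g ((M + r) * (u g + 1) + r) := by
    intro y hy
    obtain ⟨hyg, hyC, γ, hγC, hγ0, hγy, hγ⟩ :=
      exists_stepFunction_of_reflTransGen hSpos hr hg hy
    have h1 := hγ (-1) (u g - u y) (by linarith) (M + r) fun x _ => by
      linarith [hM _ (hγC x)]
    rw [hγy _ le_rfl, hγ0 _ (by norm_num)] at h1
    have h2 := hu.nonneg y hyC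
    rw [Metric.mem_closedBall, dist_eq_norm]
    have h3 : (M + r) * (u g - u y - -1) ≤ (M + r) * (u g + 1) :=
      mul_le_mul_of_nonneg_left (by linarith) (by linarith)
    linarith
  have hcomp : IsCompact (closure R) :=
    (isCompact_closedBall _ _).of_isClosed_subset isClosed_closure
      (closure_minimal hbdd Metric.isClosed_closedBall)
  have hclC : closure R ⊆ C := closure_minimal hRC hC
  have hne : (closure R).Nonempty := ⟨g, subset_closure Relation.ReflTransGen.refl⟩
  obtain ⟨z, hz, hmin⟩ := hcomp.exists_isMinOn hne (hu.cont.mono hclC)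
  have hzs : z = s := by
    by_contra hzs
    have hzC := hclC hz
    have hSz := hSpos z hzC
    have hlt : (S z + r)⁻¹ < (S z)⁻¹ := by gcongr; linarith
    obtain ⟨y, hyC, hyr, hy⟩ := hu.exists_descent hC hSc hSpos hzC hzs
      (inv_nonneg.2 (by linarith)) hlt hr
    have hy' : ‖y - z‖ < (S z + r) * (u z - u y) := by
      have h1 : (S z + r)⁻¹ * ‖y - z‖ < u z - u y := by linarith
      rwa [inv_mul_lt_iff₀ (by linarith)] at h1
    have hyz : u y < u z := by
      have : 0 ≤ (S z + r)⁻¹ * ‖y - z‖ := mul_nonneg (inv_nonneg.2 (by linarith)) (norm_nonneg _)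
      linarith
    have hcont : ContinuousWithinAt (fun x => (S x + r) * (u x - u y)) C z :=
      ((hSc z hzC).add continuousWithinAt_const).mul
        ((hu.cont z hzC).sub continuousWithinAt_const)
    have hcont' : ContinuousWithinAt (fun x => ‖y - x‖) C z := by fun_prop
    have hev : ∀ᶠ x in 𝓝[C] z, ‖y - x‖ < r ∧ ‖y - x‖ < (S x + r) * (u x - u y) :=
      (hcont'.eventually (gt_mem_nhds hyr)).and (hcont'.eventually_lt hcont hy')
    obtain ⟨x, ⟨-, hx1, hx2⟩, hxR⟩ := mem_closure_iff_nhdsWithin_neBot.1 hz |>.nonempty_of_mem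
      (inter_mem (inter_mem (mem_of_superset self_mem_nhdsWithin hRC)
        (nhdsWithin_mono z hRC hev)) self_mem_nhdsWithin)
    have hyR : y ∈ R := Relation.ReflTransGen.tail hxR ⟨hyC, hx1, hx2.le⟩
    exact hyz.not_ge (hmin (subset_closure hyR))
  obtain ⟨y, hy, hyr⟩ := Metric.mem_closure_iff.1 (hzs ▸ hz) r hr
  exact ⟨y, hy, by rwa [dist_comm, dist_eq_norm] at hyr⟩

/-- From every point `g` of `C` the source is reached, along a curve in `C` that respects the
speed limit, in the time `u g`. The curve is a limit along an ultrafilter of the step functions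
of finer and finer chains of descent steps. -/
theorem exists_curve (hu : IsViscositySolutionFrom C S s u) (hC : IsClosed C)
    (hSc : ContinuousOn S C) (hSpos : ∀ x ∈ C, 0 < S x) (hSbdd : ∃ M : ℝ, ∀ x ∈ C, S x ≤ M)
    {g : Conf d} (hg : g ∈ C) :
    ∃ (γ : ℝ → Conf d) (K : ℝ≥0), LipschitzWith K γ ∧ (∀ t, γ t ∈ C) ∧ γ 0 = g ∧ γ (u g) = s ∧
      ∀ t, ‖deriv γ t‖ ≤ S (γ t) := by
  obtain ⟨M, hM⟩ := hSbdd
  have hM0 : 0 < M := (hSpos g hg).trans_le (hM g hg)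
  set r : ℕ → ℝ := fun n => 1 / ((n : ℝ) + 1) with hr
  have hrpos : ∀ n, 0 < r n := fun n => by positivity
  have hr1 : ∀ n, r n ≤ 1 := fun n => by
    rw [hr]
    exact (div_le_one (by positivity)).2 (by linarith [n.cast_nonneg (α := ℝ)])
  have hr0 : Tendsto r atTop (𝓝 0) := tendsto_one_div_add_atTop_nhds_zero_nat
  choose y hyR hys using fun n =>
    hu.exists_reflTransGen_norm_sub_lt hC hSc hSpos hM hg (hrpos n)
  choose hyg hyC γ hγC hγ0 hγy hγ using fun n =>
    exists_stepFunction_of_reflTransGen hSpos (hrpos n) hg (hyR n)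
  have hγM : ∀ n t t', t ≤ t' → ‖γ n t' - γ n t‖ ≤ (M + 1) * (t' - t) + r n := fun n t t' h =>
    hγ n t t' h (M + 1) fun x _ => by linarith [hM _ (hγC n x), hr1 n]
  set l : Filter ℕ := (hyperfilter ℕ : Filter ℕ) with hl
  have hl_le : l ≤ atTop := Nat.hyperfilter_le_atTop
  have hex : ∀ t, ∃ x ∈ C, Tendsto (fun n => γ n t) l (𝓝 x) := by
    intro t
    have hcomp : IsCompact (C ∩ Metric.closedBall g ((M + 1) * (|t| + 1) + 1)) :=
      (isCompact_closedBall _ _).inter_left hC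
    have hmem : ∀ n, γ n t ∈ C ∩ Metric.closedBall g ((M + 1) * (|t| + 1) + 1) := by
      intro n
      refine ⟨hγC n t, ?_⟩
      rw [Metric.mem_closedBall, dist_eq_norm]
      rcases lt_or_ge t 0 with ht | ht
      · rw [hγ0 n t ht, sub_self, norm_zero]
        positivity
      · have h1 := hγM n (-1) t (by linarith)
        rw [hγ0 n (-1) (by norm_num)] at h1
        rw [abs_of_nonneg ht]
        linarith [hr1 n]
    obtain ⟨x, hx, hlim⟩ := hcomp.ultrafilter_le_nhds ((hyperfilter ℕ).map fun n => γ n t)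
      (le_principal_iff.2 (Filter.mem_map.2 (Filter.univ_mem' hmem)))
    exact ⟨x, hx.1, hlim⟩
  choose Γ hΓC hΓ using hex
  have hΓM : ∀ t t', t ≤ t' → ‖Γ t' - Γ t‖ ≤ (M + 1) * (t' - t) := by
    intro t t' htt'
    have h1 : Tendsto (fun n => (M + 1) * (t' - t) + r n) l (𝓝 ((M + 1) * (t' - t) + 0)) :=
      tendsto_const_nhds.add (hr0.mono_left hl_le)
    rw [add_zero] at h1
    exact le_of_tendsto_of_tendsto' ((hΓ t').sub (hΓ t)).norm h1 fun n => hγM n t t' htt'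
  have hLip : LipschitzWith (M + 1).toNNReal Γ := by
    refine LipschitzWith.of_dist_le_mul fun t t' => ?_
    rw [Real.coe_toNNReal _ (by linarith), dist_eq_norm, Real.dist_eq]
    rcases le_total t t' with h | h
    · rw [norm_sub_rev, abs_sub_comm, abs_of_nonneg (sub_nonneg.2 h)]
      exact hΓM t t' h
    · rw [abs_of_nonneg (sub_nonneg.2 h)]
      exact hΓM t' t h
  refine ⟨Γ, _, hLip, hΓC, ?_, ?_, fun t => ?_⟩
  · have h1 : ∀ t < 0, Γ t = g := fun t ht =>
      tendsto_nhds_unique (hΓ t) (tendsto_const_nhds.congr fun n => (hγ0 n t ht).symm)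
    have h2 : Tendsto Γ (𝓝[<] 0) (𝓝 (Γ 0)) := (hLip.continuous.tendsto 0).mono_left
      nhdsWithin_le_nhds
    refine tendsto_nhds_unique h2 (tendsto_const_nhds.congr' ?_)
    filter_upwards [self_mem_nhdsWithin] with t ht using (h1 t ht).symm
  · have h1 : Tendsto y atTop (𝓝 s) := by
      rw [tendsto_iff_norm_sub_tendsto_zero]
      exact squeeze_zero (fun n => norm_nonneg _) (fun n => (hys n).le) hr0
    refine tendsto_nhds_unique (hΓ (u g)) ((h1.mono_left hl_le).congr fun n => ?_)
    exact (hγy n (u g) (by linarith [hu.nonneg _ (hyC n)])).symm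
  · refine le_of_forall_pos_le_add fun ε hε => ?_
    have hSt := hSpos _ (hΓC t)
    have hev : ∀ᶠ x in 𝓝[C] (Γ t), S x < S (Γ t) + ε / 2 :=
      (hSc _ (hΓC t)).eventually (gt_mem_nhds (by linarith))
    obtain ⟨δ, hδ, hball⟩ := (nhdsWithin_hasBasis Metric.nhds_basis_ball C).mem_iff.1 hev
    set θ : ℝ := δ / (4 * (M + 1)) with hθ
    have hθpos : 0 < θ := by positivity
    have hMθ : (M + 1) * θ = δ / 4 := by rw [hθ]; field_simp
    have hlarge : ∀ᶠ n in l, r n < ε / 2 ∧ r n < δ / 4 ∧ ‖γ n t - Γ t‖ < δ / 4 :=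
      ((hr0.mono_left hl_le).eventually (gt_mem_nhds (by linarith))).and
        (((hr0.mono_left hl_le).eventually (gt_mem_nhds (by linarith))).and
          ((tendsto_iff_norm_sub_tendsto_zero.1 (hΓ t)).eventually (gt_mem_nhds (by linarith))))
    have hloc : ∀ t₁ t₂, t₁ ≤ t₂ → t - θ ≤ t₁ → t₂ ≤ t + θ →
        ‖Γ t₂ - Γ t₁‖ ≤ (S (Γ t) + ε) * (t₂ - t₁) := by
      intro t₁ t₂ h12 h1 h2
      have hlim : Tendsto (fun n => (S (Γ t) + ε) * (t₂ - t₁) + r n) l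
          (𝓝 ((S (Γ t) + ε) * (t₂ - t₁) + 0)) :=
        tendsto_const_nhds.add (hr0.mono_left hl_le)
      rw [add_zero] at hlim
      refine le_of_tendsto_of_tendsto ((hΓ t₂).sub (hΓ t₁)).norm hlim ?_
      filter_upwards [hlarge] with n ⟨hn1, hn2, hn3⟩
      refine hγ n t₁ t₂ h12 _ fun x hx => ?_
      have hxt : ‖γ n x - γ n t‖ ≤ (M + 1) * θ + r n := by
        rcases le_total t x with h | h
        · have h3 : (M + 1) * (x - t) ≤ (M + 1) * θ :=
            mul_le_mul_of_nonneg_left (by linarith [hx.2]) (by linarith)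
          linarith [hγM n t x h]
        · have h3 : (M + 1) * (t - x) ≤ (M + 1) * θ :=
            mul_le_mul_of_nonneg_left (by linarith [hx.1]) (by linarith)
          rw [norm_sub_rev]
          linarith [hγM n x t h]
      have hxΓ : γ n x ∈ Metric.ball (Γ t) δ := by
        rw [Metric.mem_ball, dist_eq_norm]
        have := norm_sub_le_norm_sub_add_norm_sub (γ n x) (γ n t) (Γ t)
        linarith
      have h3 : S (γ n x) < S (Γ t) + ε / 2 := hball ⟨hxΓ, hγC n x⟩
      linarith
    refine norm_deriv_le_of_lip' (by linarith) ?_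
    filter_upwards [Icc_mem_nhds (show t - θ < t by linarith) (show t < t + θ by linarith)]
      with t' ht'
    rw [Real.norm_eq_abs]
    rcases le_total t t' with h | h
    · rw [abs_of_nonneg (sub_nonneg.2 h)]
      exact hloc t t' h (by linarith) ht'.2
    · rw [norm_sub_rev, abs_sub_comm, abs_of_nonneg (sub_nonneg.2 h)]
      exact hloc t' t h ht'.1 (by linarith)

end IsViscositySolutionFrom

end

/-! ### The time field along optimal paths and descent paths -/

theorem lipschitzOnWith_of_hasDerivAt_Ioo {d : ℕ} {η η' : ℝ → Conf d} {a b : ℝ} {K : ℝ≥0}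
    (hη : ContinuousOn η (Icc a b)) (hd : ∀ t ∈ Ioo a b, HasDerivAt η (η' t) t)
    (hK : ∀ t ∈ Ioo a b, ‖η' t‖ ≤ K) : LipschitzOnWith K η (Icc a b) := by
  rcases le_or_gt b a with hab | hab
  · intro x hx y hy
    simp [subsingleton_Icc_of_ge hab hx hy]
  have h1 : LipschitzOnWith K η (Ioo a b) :=
    (convex_Ioo a b).lipschitzOnWith_of_nnnorm_hasDerivWithin_le
      (fun t ht => (hd t ht).hasDerivWithinAt) hK
  rw [← closure_Ioo hab.ne] at hη ⊢
  exact h1.closure hη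

theorem interior_free_subset {d : ℕ} {C Cobs : Set (Conf d)} :
    interior (free C Cobs) ⊆ interior C :=
  interior_mono sdiff_subset

theorem fderiv_prodMk_eq_inner_gradient {d : ℕ} {T : Conf d → Conf d → ℝ} {x y : Conf d}
    (h : DifferentiableAt ℝ (fun p : Conf d × Conf d => T p.1 p.2) (x, y)) (v w : Conf d) :
    fderiv ℝ (fun p : Conf d × Conf d => T p.1 p.2) (x, y) (v, w) =
      inner ℝ (gradient (fun z => T z y) x) v + inner ℝ (gradient (fun z => T x z) y) w := by
  have h1 := h.hasFDerivAt.comp (f := fun z => (z, y)) x (hasFDerivAt_prodMk_left x y)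
  have h2 := h.hasFDerivAt.comp (f := fun z => (x, z)) y (hasFDerivAt_prodMk_right x y)
  have e1 : fderiv ℝ (fun z => T z y) x = _ := h1.fderiv
  have e2 : fderiv ℝ (fun z => T x z) y = _ := h2.fderiv
  rw [inner_gradient_left, inner_gradient_left, e1, e2]
  simp [← map_add]

/-- A variant of `IsViscositySolutionFrom.le_add_sub` for curves that are differentiable away from
the end points: they are Lipschitz, as `S` is bounded. -/
theorem IsViscositySolutionFrom.le_add_sub_of_hasDerivAt {d : ℕ} {C : Set (Conf d)}
    {S : Conf d → ℝ} {s : Conf d} {u : Conf d → ℝ} (hu : IsViscositySolutionFrom C S s u)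
    (hb : HasLipschitzBoundary C)
    (hSc : ContinuousOn S C) (hSpos : ∀ x ∈ C, 0 < S x) (hSbdd : ∃ M : ℝ, ∀ x ∈ C, S x ≤ M)
    {η η' : ℝ → Conf d} {a b : ℝ} (hab : a ≤ b) (hη : ContinuousOn η (Icc a b))
    (hC : MapsTo η (Icc a b) C) (hd : ∀ t ∈ Ioo a b, HasDerivAt η (η' t) t)
    (hspeed : ∀ t ∈ Ioo a b, ‖η' t‖ ≤ S (η t)) : u (η b) ≤ u (η a) + (b - a) := by
  obtain ⟨M, hM⟩ := hSbdd
  refine hu.le_add_sub hb hSc hSpos hab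
    (lipschitzOnWith_of_hasDerivAt_Ioo (K := M.toNNReal) hη hd fun t ht => ?_) hC fun t ht => ?_
  · exact (hspeed t ht).trans ((hM _ (hC (Ioo_subset_Icc_self ht))).trans (Real.le_coe_toNNReal M))
  · rw [(hd t ht).deriv]
    exact hspeed t ht

namespace IsViscositySolution

variable {d : ℕ} {C Cobs : Set (Conf d)} {S : Conf d → ℝ} {T : Conf d → Conf d → ℝ}
  {s g w x y z : Conf d}

/-- The triangle inequality, with one time reversed: `T x` is followed along the curve from `y` to
`z` that the solution `T z` provides. Its case `y = x` is the symmetry of `T`. -/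
theorem triangle_reversed (hT : IsViscositySolution C Cobs S T) (hC : IsClosed C)
    (hb : HasLipschitzBoundary C) (hSc : ContinuousOn S C) (hSpos : ∀ x ∈ C, 0 < S x)
    (hSbdd : ∃ M : ℝ, ∀ x ∈ C, S x ≤ M) (hx : x ∈ free C Cobs) (hy : y ∈ free C Cobs)
    (hz : z ∈ free C Cobs) : T x z ≤ T x y + T z y := by
  obtain ⟨γ, K, hγ, hγC, h0, h1, hsp⟩ := (hT z hz).exists_curve hC hSc hSpos hSbdd hy.1
  have := (hT x hx).le_add_sub hb hSc hSpos ((hT z hz).nonneg y hy.1)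
    (hγ.lipschitzOnWith (s := Icc 0 (T z y))) (fun t _ => hγC t) (fun t _ => hsp t)
  rwa [h0, h1, sub_zero] at this

theorem symm (hT : IsViscositySolution C Cobs S T) (hC : IsClosed C)
    (hb : HasLipschitzBoundary C) (hSc : ContinuousOn S C) (hSpos : ∀ x ∈ C, 0 < S x)
    (hSbdd : ∃ M : ℝ, ∀ x ∈ C, S x ≤ M) (hx : x ∈ free C Cobs) (hy : y ∈ free C Cobs) :
    T x y = T y x := by
  have h1 := hT.triangle_reversed hC hb hSc hSpos hSbdd hx hx hy
  have h2 := hT.triangle_reversed hC hb hSc hSpos hSbdd hy hy hx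
  rw [(hT x hx).source] at h1
  rw [(hT y hy).source] at h2
  linarith

theorem triangle (hT : IsViscositySolution C Cobs S T) (hC : IsClosed C)
    (hb : HasLipschitzBoundary C) (hSc : ContinuousOn S C) (hSpos : ∀ x ∈ C, 0 < S x)
    (hSbdd : ∃ M : ℝ, ∀ x ∈ C, S x ≤ M) (hx : x ∈ free C Cobs) (hy : y ∈ free C Cobs)
    (hz : z ∈ free C Cobs) : T x z ≤ T x y + T y z := by
  rw [hT.symm hC hb hSc hSpos hSbdd hy hz]
  exact hT.triangle_reversed hC hb hSc hSpos hSbdd hx hy hz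

/-- Joint continuity follows from the triangle inequality and the continuity of each `T x` at its
source `x`. -/
theorem continuousOn (hT : IsViscositySolution C Cobs S T) (hC : IsClosed C)
    (hb : HasLipschitzBoundary C) (hSc : ContinuousOn S C) (hSpos : ∀ x ∈ C, 0 < S x)
    (hSbdd : ∃ M : ℝ, ∀ x ∈ C, S x ≤ M) :
    ContinuousOn (fun p : Conf d × Conf d => T p.1 p.2) (free C Cobs ×ˢ free C Cobs) := by
  rintro ⟨x, y⟩ ⟨hx, hy⟩
  have hx : x ∈ free C Cobs := hx
  have hy : y ∈ free C Cobs := hy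
  have hlim : ∀ z ∈ free C Cobs, Tendsto (T z) (𝓝[free C Cobs] z) (𝓝 0) := fun z hz => by
    have : ContinuousWithinAt (T z) (free C Cobs) z := ((hT z hz).cont z hz.1).mono sdiff_subset
    rwa [ContinuousWithinAt, (hT z hz).source] at this
  have h1 : Tendsto (fun p : Conf d × Conf d => T x p.1 + T y p.2)
      (𝓝[free C Cobs ×ˢ free C Cobs] (x, y)) (𝓝 (0 + 0)) := by
    rw [nhdsWithin_prod_eq]
    exact ((hlim x hx).comp tendsto_fst).add ((hlim y hy).comp tendsto_snd)
  rw [add_zero] at h1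
  rw [ContinuousWithinAt, tendsto_iff_norm_sub_tendsto_zero]
  refine squeeze_zero' (Eventually.of_forall fun _ => norm_nonneg _) ?_ h1
  filter_upwards [self_mem_nhdsWithin] with p ⟨hp1, hp2⟩
  have t := fun {x y z} => hT.triangle hC hb hSc hSpos hSbdd (x := x) (y := y) (z := z)
  have e1 := hT.symm hC hb hSc hSpos hSbdd hx hp1
  have e2 := hT.symm hC hb hSc hSpos hSbdd hy hp2
  have t1 := t hp1 hx hp2
  have t2 := t hx hy hp2
  have t3 := t hx hp1 hy
  have t4 := t hp1 hp2 hy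
  rw [Real.norm_eq_abs, abs_le]
  constructor <;> linarith

/-- Along an optimal path the time field is additive: it is bounded above by the travel time of
each part, and below by the travel time of a curve that the equation provides. -/
theorem lt_of_onOptimalPath (hT : IsViscositySolution C Cobs S T) (hC : IsClosed C)
    (hb : HasLipschitzBoundary C) (hSc : ContinuousOn S C) (hSpos : ∀ x ∈ C, 0 < S x)
    (hSbdd : ∃ M : ℝ, ∀ x ∈ C, S x ≤ M) (hs : s ∈ free C Cobs) (hg : g ∈ free C Cobs)
    (hw : w ∈ free C Cobs) (hws : w ≠ s) (hwg : w ≠ g) (h : OnOptimalPath C S s g w) :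
    T s w < T s g ∧ T w g < T s g := by
  obtain ⟨γ, hγ, hopt, t₀, ht₀, rfl⟩ := h
  obtain ⟨K, hK⟩ := hγ.lipschitz
  have hsub1 : Icc 0 t₀ ⊆ Icc (0 : ℝ) 1 := Icc_subset_Icc_right ht₀.2
  have hsub2 : Icc t₀ 1 ⊆ Icc (0 : ℝ) 1 := Icc_subset_Icc_left ht₀.1
  have h1 := (hT s hs).le_add_integral hb hSc hSpos ht₀.1 (hK.mono hsub1)
    (hγ.mapsTo.mono_left hsub1)
  have h2 := (hT _ hw).le_add_integral hb hSc hSpos ht₀.2 (hK.mono hsub2)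
    (hγ.mapsTo.mono_left hsub2)
  rw [hγ.start, (hT s hs).source, zero_add] at h1
  rw [hγ.goal, (hT _ hw).source, zero_add] at h2
  have h3 := intervalIntegral.integral_add_adjacent_intervals
    (intervalIntegrable_norm_deriv_div hSc hSpos ht₀.1 (hK.mono hsub1)
      (hγ.mapsTo.mono_left hsub1))
    (intervalIntegrable_norm_deriv_div hSc hSpos ht₀.2 (hK.mono hsub2)
      (hγ.mapsTo.mono_left hsub2))
  have p1 := (hT s hs).pos hC hSc hSpos hw.1 hws
  have p2 := (hT _ hw).pos hC hSc hSpos hg.1 hwg.symm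
  obtain ⟨Γ, L, hΓ, hΓC, hΓ0, hΓ1, hsp⟩ := (hT s hs).exists_curve hC hSc hSpos hSbdd hg.1
  set τ := T s g with hτ
  have hτ0 : 0 ≤ τ := (hT s hs).nonneg g hg.1
  -- the curve that attains the time, reversed and rescaled to `[0, 1]`
  have hcurve : IsCurve C s g (fun t => Γ (τ - τ * t)) := by
    refine ⟨⟨L * ‖τ‖₊, ?_⟩, fun t _ => hΓC _, by simpa using hΓ1, by simpa using hΓ0⟩
    refine (hΓ.comp (LipschitzWith.of_dist_le_mul fun t t' => ?_)).lipschitzOnWith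
    rw [Real.dist_eq, Real.dist_eq, abs_sub_comm t, coe_nnnorm, Real.norm_eq_abs, ← abs_mul]
    exact le_of_eq (congrArg _ (by ring))
  have htime : travelTime S (fun t => Γ (τ - τ * t)) ≤ τ := by
    obtain ⟨L', hL'⟩ := hcurve.lipschitz
    have hle : ∀ t ∈ Icc (0 : ℝ) 1, ‖deriv (fun t => Γ (τ - τ * t)) t‖ / S (Γ (τ - τ * t)) ≤ τ := by
      intro t _
      have hd : deriv (fun t => Γ (τ - τ * t)) t = τ • -deriv Γ (τ - τ * t) := by
        rw [deriv_comp_mul_left τ (fun x => Γ (τ - x)) t, deriv_comp_const_sub]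
      rw [hd, norm_smul, norm_neg, Real.norm_of_nonneg hτ0, div_le_iff₀ (hSpos _ (hΓC _))]
      exact mul_le_mul_of_nonneg_left (hsp _) hτ0
    have := intervalIntegral.integral_mono_on zero_le_one
      (intervalIntegrable_norm_deriv_div hSc hSpos zero_le_one hL' hcurve.mapsTo)
      intervalIntegrable_const hle
    simpa [travelTime] using this
  have h4 := (hopt _ hcurve).trans htime
  rw [travelTime] at h4
  constructor <;> linarith

/-- Gradient descent decreases the time field at rate one and moves at speed `S`. It cannot pass
through the source before it ends there, since the time field, which is zero only at the source,
does not increase. -/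
theorem lt_of_onDescentPath (hT : IsViscositySolution C Cobs S T) (hC : IsClosed C)
    (hb : HasLipschitzBoundary C) (hSc : ContinuousOn S C) (hSpos : ∀ x ∈ C, 0 < S x)
    (hSbdd : ∃ M : ℝ, ∀ x ∈ C, S x ≤ M) (hs : s ∈ free C Cobs) (hg : g ∈ free C Cobs)
    (hw : w ∈ free C Cobs) (hws : w ≠ s) (hwg : w ≠ g) (h : OnDescentPath C S T s g w) :
    T s w < T s g ∧ T w g < T s g := by
  obtain ⟨τ, γ, -, hγ, rfl, rfl, hode, t₀, ht₀, rfl⟩ := h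
  have hu := hT _ hs
  have h0 : 0 < t₀ := ht₀.1.lt_of_ne (by rintro rfl; exact hwg rfl)
  have hτ : t₀ < τ := ht₀.2.lt_of_ne (by rintro rfl; exact hws rfl)
  have hγC : MapsTo γ (Icc 0 τ) C := by
    intro t ht
    rcases ht.1.eq_or_lt with rfl | h1
    · exact hg.1
    rcases ht.2.eq_or_lt with rfl | h2
    · exact hs.1
    exact interior_subset (hode t ⟨h1, h2⟩).1
  have hfc : ContinuousOn (fun t => T (γ τ) (γ t)) (Icc 0 τ) := hu.cont.comp hγ hγC
  have hfd : ∀ t ∈ Ioo 0 τ, HasDerivAt (fun t => T (γ τ) (γ t))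
      (-(S (γ t) ^ 2 * ‖gradient (T (γ τ)) (γ t)‖ ^ 2)) t := by
    intro t ht
    obtain ⟨-, hdiff, hder⟩ := hode t ht
    have := hdiff.hasFDerivAt.comp_hasDerivAt t hder
    rwa [← inner_gradient_left, inner_neg_right, inner_smul_right, real_inner_self_eq_norm_sq]
      at this
  have hanti : AntitoneOn (fun t => T (γ τ) (γ t)) (Icc 0 τ) := by
    refine antitoneOn_of_deriv_nonpos (convex_Icc 0 τ) hfc ?_ ?_
    · rw [interior_Icc]
      exact fun t ht => (hfd t ht).differentiableAt.differentiableWithinAt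
    · rw [interior_Icc]
      intro t ht
      rw [(hfd t ht).deriv]
      exact neg_nonpos.2 (by positivity)
  have hpos := hu.pos hC hSc hSpos hw.1 hws
  have hnorm : ∀ t ∈ Ioo 0 t₀, S (γ t) * ‖gradient (T (γ τ)) (γ t)‖ = 1 := by
    intro t ht
    have ht' : t ∈ Ioo 0 τ := ⟨ht.1, ht.2.trans hτ⟩
    obtain ⟨hi, hdiff, -⟩ := hode t ht'
    have hne : γ t ≠ γ τ := by
      intro heq
      have := hanti (Ioo_subset_Icc_self ht') ht₀ ht.2.le
      simp only [heq, hu.source] at this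
      linarith
    rw [hu.norm_gradient_eq hC hSc hSpos hi hne hdiff]
    exact mul_inv_cancel₀ (hSpos _ (interior_subset hi)).ne'
  have hsub : Icc 0 t₀ ⊆ Icc 0 τ := Icc_subset_Icc_right hτ.le
  obtain ⟨c, hc, hslope⟩ := exists_hasDerivAt_eq_slope (fun t => T (γ τ) (γ t)) _ h0
    (hfc.mono hsub) fun t ht => hfd t ⟨ht.1, ht.2.trans hτ⟩
  rw [← mul_pow, hnorm c hc, sub_zero, eq_div_iff h0.ne'] at hslope
  have hup := (hT _ hg).le_add_sub_of_hasDerivAt hb hSc hSpos hSbdd h0.le (hγ.mono hsub)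
    (hγC.mono_left hsub) (fun t ht => (hode t ⟨ht.1, ht.2.trans hτ⟩).2.2) fun t ht => by
      have h1 := hSpos _ (hγC (hsub (Ioo_subset_Icc_self ht)))
      rw [norm_neg, norm_smul, Real.norm_of_nonneg (by positivity), pow_two, mul_assoc,
        hnorm t ht, mul_one]
  rw [(hT _ hg).source, hT.symm hC hb hSc hSpos hSbdd hg hw] at hup
  constructor <;> linarith

/-- Bidirectional gradient descent decreases the time field at rate two, as each of its curves
moves at speed `S`: by symmetry the time field solves the equation in its first variable too. If
the curves meet early, both remain there. -/
theorem lt_of_onBidirectionalPath (hT : IsViscositySolution C Cobs S T) (hC : IsClosed C)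
    (hb : HasLipschitzBoundary C) (hSc : ContinuousOn S C) (hSpos : ∀ x ∈ C, 0 < S x)
    (hSbdd : ∃ M : ℝ, ∀ x ∈ C, S x ≤ M) (hs : s ∈ free C Cobs) (hg : g ∈ free C Cobs)
    (hw : w ∈ free C Cobs) (hws : w ≠ s) (hwg : w ≠ g)
    (h : OnBidirectionalPath C Cobs S T s g w) :
    T s w < T s g ∧ T w g < T s g := by
  obtain ⟨τ, a, b, -, ha, hb', rfl, rfl, hend, hode, hwab⟩ := h
  have hsymm := fun {x y} => hT.symm hC hb hSc hSpos hSbdd (x := x) (y := y)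
  have htri := fun {x y z} => hT.triangle hC hb hSc hSpos hSbdd (x := x) (y := y) (z := z)
  have hfree : ∀ t ∈ Ico 0 τ, a t ∈ free C Cobs ∧ b t ∈ free C Cobs := by
    intro t ht
    rcases ht.1.eq_or_lt with rfl | h1
    · exact ⟨hs, hg⟩
    · exact ⟨interior_subset (hode t ⟨h1, ht.2⟩).1, interior_subset (hode t ⟨h1, ht.2⟩).2.1⟩
  have hfc : ∀ I ⊆ Icc 0 τ, (∀ t ∈ I, a t ∈ free C Cobs ∧ b t ∈ free C Cobs) →
      ContinuousOn (fun t => T (a t) (b t)) I := fun I hI hIf =>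
    (hT.continuousOn hC hb hSc hSpos hSbdd).comp
      ((ha.mono hI).prodMk (hb'.mono hI)) fun t ht => ⟨(hIf t ht).1, (hIf t ht).2⟩
  have hfd : ∀ t ∈ Ioo 0 τ, HasDerivAt (fun t => T (a t) (b t))
      (-(S (a t) ^ 2 * ‖gradient (fun x => T x (b t)) (a t)‖ ^ 2) -
        S (b t) ^ 2 * ‖gradient (fun y => T (a t) y) (b t)‖ ^ 2) t := by
    intro t ht
    obtain ⟨-, -, hdiff, hda, hdb⟩ := hode t ht
    have := hdiff.hasFDerivAt.comp_hasDerivAt t (hda.prodMk hdb)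
    rw [fderiv_prodMk_eq_inner_gradient hdiff] at this
    simp only [inner_neg_right, inner_smul_right, real_inner_self_eq_norm_sq, ← sub_eq_add_neg]
      at this
    exact this
  have hanti : AntitoneOn (fun t => T (a t) (b t)) (Ico 0 τ) := by
    refine antitoneOn_of_deriv_nonpos (convex_Ico 0 τ) (hfc _ Ico_subset_Icc_self hfree) ?_ ?_
    · rw [interior_Ico]
      exact fun t ht => (hfd t ht).differentiableAt.differentiableWithinAt
    · rw [interior_Ico]
      intro t ht
      rw [(hfd t ht).deriv]
      have h1 : 0 ≤ S (a t) ^ 2 * ‖gradient (fun x => T x (b t)) (a t)‖ ^ 2 := by positivity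
      have h2 : 0 ≤ S (b t) ^ 2 * ‖gradient (fun y => T (a t) y) (b t)‖ ^ 2 := by positivity
      linarith
  -- where the two curves have met, the nonnegative time field is minimal, and its gradient is zero
  have hmeet : ∀ t₁ t₀, 0 ≤ t₁ → t₁ ≤ t₀ → t₀ ≤ τ → a t₁ = b t₁ → a t₀ = a t₁ ∧ b t₀ = b t₁ := by
    intro t₁ t₀ h1 h10 h0 heq
    rcases h10.eq_or_lt with rfl | h10'
    · exact ⟨rfl, rfl⟩
    have hgrad : ∀ t ∈ Ioo t₁ t₀, gradient (fun x => T x (b t)) (a t) = 0 ∧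
        gradient (fun y => T (a t) y) (b t) = 0 := by
      intro t ht
      have htI : t ∈ Ioo 0 τ := ⟨h1.trans_lt ht.1, ht.2.trans_le h0⟩
      obtain ⟨hai, hbi, hdiff, -, -⟩ := hode t htI
      obtain ⟨haf, hbf⟩ := hfree t ⟨htI.1.le, htI.2⟩
      have hle := hanti ⟨h1, ht.1.trans htI.2⟩ ⟨htI.1.le, htI.2⟩ ht.1.le
      have hz : T (a t) (b t) ≤ 0 := by
        simpa only [heq, (hT _ (hfree t₁ ⟨h1, ht.1.trans htI.2⟩).2).source] using hle
      have hm1 : IsLocalMin (fun x => T x (b t)) (a t) := by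
        filter_upwards [mem_interior_iff_mem_nhds.1 hai] with x hx
        exact hz.trans ((hT x hx).nonneg _ hbf.1)
      have hm2 : IsLocalMin (fun y => T (a t) y) (b t) := by
        filter_upwards [mem_interior_iff_mem_nhds.1 hbi] with y hy
        exact hz.trans ((hT _ haf).nonneg y hy.1)
      simp [gradient, hm1.fderiv_eq_zero, hm2.fderiv_eq_zero]
    have hconst : ∀ η : ℝ → Conf d, ContinuousOn η (Icc 0 τ) →
        (∀ t ∈ Ioo t₁ t₀, HasDerivAt η 0 t) → η t₀ = η t₁ := by
      intro η hη hd
      have := lipschitzOnWith_of_hasDerivAt_Ioo (K := 0) (hη.mono (Icc_subset_Icc h1 h0)) hd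
        (fun t _ => by simp)
      simpa using this.dist_le_mul t₀ (right_mem_Icc.2 h10) t₁ (left_mem_Icc.2 h10)
    refine ⟨hconst a ha fun t ht => ?_, hconst b hb' fun t ht => ?_⟩
    · have := (hode t ⟨h1.trans_lt ht.1, ht.2.trans_le h0⟩).2.2.2.1
      simpa [(hgrad t ht).1] using this
    · have := (hode t ⟨h1.trans_lt ht.1, ht.2.trans_le h0⟩).2.2.2.2
      simpa [(hgrad t ht).2] using this
  -- a waypoint is visited no later than at the first meeting of the curves
  obtain ⟨t₀, ht₀, hne, hwt⟩ : ∃ t₀ ∈ Icc 0 τ, (∀ t ∈ Ico 0 t₀, a t ≠ b t) ∧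
      (a t₀ = w ∨ b t₀ = w) := by
    obtain ⟨t₂, ht₂, hwt₂⟩ : ∃ t₂ ∈ Icc 0 τ, a t₂ = w ∨ b t₂ = w := by
      rcases hwab with ⟨t, ht, rfl⟩ | ⟨t, ht, rfl⟩
      exacts [⟨t, ht, Or.inl rfl⟩, ⟨t, ht, Or.inr rfl⟩]
    have hsub : Icc 0 t₂ ⊆ Icc 0 τ := Icc_subset_Icc_right ht₂.2
    have hcl : IsClosed (Icc 0 t₂ ∩ (fun t => a t - b t) ⁻¹' {0}) :=
      ((ha.mono hsub).sub (hb'.mono hsub)).preimage_isClosed_of_isClosed isClosed_Icc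
        isClosed_singleton
    have hcpt : IsCompact ((Icc 0 t₂ ∩ (fun t => a t - b t) ⁻¹' {0}) ∪ {t₂}) :=
      (isCompact_Icc.of_isClosed_subset hcl inter_subset_left).union isCompact_singleton
    obtain ⟨t₀, ht₀, hmin⟩ := hcpt.exists_isLeast ⟨t₂, Or.inr rfl⟩
    have ht₀2 : t₀ ≤ t₂ := hmin (Or.inr rfl)
    have hstay : 0 ≤ t₀ ∧ a t₂ = a t₀ ∧ b t₂ = b t₀ := by
      rcases ht₀ with ⟨ht, heq⟩ | rfl
      · exact ⟨ht.1, hmeet t₀ t₂ ht.1 ht.2 ht₂.2 (sub_eq_zero.1 heq)⟩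
      · exact ⟨ht₂.1, rfl, rfl⟩
    refine ⟨t₀, ⟨hstay.1, ht₀2.trans ht₂.2⟩, fun t ht heq => ?_, ?_⟩
    · exact ht.2.not_ge (hmin (Or.inl ⟨⟨ht.1, ht.2.le.trans ht₀2⟩, sub_eq_zero.2 heq⟩))
    · rwa [← hstay.2.1, ← hstay.2.2]
  have h0 : 0 < t₀ := ht₀.1.lt_of_ne (by
    rintro rfl
    exact hwt.elim (fun h => hws h.symm) fun h => hwg h.symm)
  have hf₀ : a t₀ ∈ free C Cobs ∧ b t₀ ∈ free C Cobs := by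
    rcases ht₀.2.eq_or_lt with rfl | hlt
    · rw [← hend] at hwt ⊢
      rw [(or_self_iff.1 hwt)]
      exact ⟨hw, hw⟩
    · exact hfree t₀ ⟨h0.le, hlt⟩
  have hf : ∀ t ∈ Icc 0 t₀, a t ∈ free C Cobs ∧ b t ∈ free C Cobs := by
    intro t ht
    rcases ht.2.eq_or_lt with rfl | hlt
    · exact hf₀
    · exact hfree t ⟨ht.1, hlt.trans_le ht₀.2⟩
  have hnorm : ∀ t ∈ Ioo 0 t₀, S (a t) * ‖gradient (fun x => T x (b t)) (a t)‖ = 1 ∧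
      S (b t) * ‖gradient (fun y => T (a t) y) (b t)‖ = 1 := by
    intro t ht
    obtain ⟨hai, hbi, hdiff, -, -⟩ := hode t ⟨ht.1, ht.2.trans_le ht₀.2⟩
    obtain ⟨haf, hbf⟩ := hf t (Ioo_subset_Icc_self ht)
    have hab := hne t (Ioo_subset_Ico_self ht)
    have hev : (fun x => T x (b t)) =ᶠ[𝓝 (a t)] T (b t) := by
      filter_upwards [mem_interior_iff_mem_nhds.1 hai] with x hx using hsymm hx hbf
    have hd1 : DifferentiableAt ℝ (fun x => T x (b t)) (a t) :=
      (hdiff.hasFDerivAt.comp (f := fun x => (x, b t)) (a t)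
        (hasFDerivAt_prodMk_left (a t) (b t))).differentiableAt
    have hd2 : DifferentiableAt ℝ (T (a t)) (b t) :=
      (hdiff.hasFDerivAt.comp (f := fun y => (a t, y)) (b t)
        (hasFDerivAt_prodMk_right (a t) (b t))).differentiableAt
    constructor
    · rw [hev.gradient_eq, (hT _ hbf).norm_gradient_eq hC hSc hSpos (interior_free_subset hai) hab
        (hd1.congr_of_eventuallyEq hev.symm)]
      exact mul_inv_cancel₀ (hSpos _ haf.1).ne'
    · rw [show (fun y => T (a t) y) = T (a t) from rfl,
        (hT _ haf).norm_gradient_eq hC hSc hSpos (interior_free_subset hbi) hab.symm hd2]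
      exact mul_inv_cancel₀ (hSpos _ hbf.1).ne'
  have hsub : Icc 0 t₀ ⊆ Icc 0 τ := Icc_subset_Icc_right ht₀.2
  obtain ⟨c, hc, hslope⟩ := exists_hasDerivAt_eq_slope (fun t => T (a t) (b t)) _ h0
    (hfc _ hsub hf) fun t ht => hfd t ⟨ht.1, ht.2.trans_le ht₀.2⟩
  rw [← mul_pow, ← mul_pow, (hnorm c hc).1, (hnorm c hc).2, sub_zero, eq_div_iff h0.ne'] at hslope
  have hA := (hT _ hs).le_add_sub_of_hasDerivAt hb hSc hSpos hSbdd h0.le (ha.mono hsub)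
    (fun t ht => (hf t ht).1.1) (fun t ht => (hode t ⟨ht.1, ht.2.trans_le ht₀.2⟩).2.2.2.1)
    fun t ht => by
      have h1 := hSpos _ (hf t (Ioo_subset_Icc_self ht)).1.1
      rw [norm_neg, norm_smul, Real.norm_of_nonneg (by positivity), pow_two, mul_assoc,
        (hnorm t ht).1, mul_one]
  have hB := (hT _ hg).le_add_sub_of_hasDerivAt hb hSc hSpos hSbdd h0.le (hb'.mono hsub)
    (fun t ht => (hf t ht).2.1) (fun t ht => (hode t ⟨ht.1, ht.2.trans_le ht₀.2⟩).2.2.2.2)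
    fun t ht => by
      have h1 := hSpos _ (hf t (Ioo_subset_Icc_self ht)).2.1
      rw [norm_neg, norm_smul, Real.norm_of_nonneg (by positivity), pow_two, mul_assoc,
        (hnorm t ht).2, mul_one]
  rw [(hT _ hs).source] at hA
  rw [(hT _ hg).source, hsymm hg hf₀.2] at hB
  have hnn := (hT _ hf₀.1).nonneg _ hf₀.2.1
  rcases hwt with rfl | rfl
  · have := htri hf₀.1 hf₀.2 hg
    constructor <;> linarith
  · have := htri hs hf₀.1 hf₀.2
    constructor <;> linarith

end IsViscositySolution

end Eikonal

theorem mainTheorem1 (d : ℕ) (C Cobs : Set (Eikonal.Conf d)) (hclosed : IsClosed C)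
    (hbdry : Eikonal.HasLipschitzBoundary C)
    (S : Eikonal.Conf d → ℝ) (hScont : ContinuousOn S C) (hSpos : ∀ x ∈ C, 0 < S x)
    (hSbdd : ∃ M : ℝ, ∀ x ∈ C, S x ≤ M)
    (T : Eikonal.Conf d → Eikonal.Conf d → ℝ)
    (hT : ¬ Eikonal.MonotonicConstraints C Cobs S T) :
    ¬ Eikonal.IsViscositySolution C Cobs S T := by
  intro hsol
  refine hT fun s hs g hg w hw ⟨hws, hwg, hpath⟩ => ?_
  rcases hpath with h | h | h
  · exact hsol.lt_of_onOptimalPath hclosed hbdry hScont hSpos hSbdd hs hg hw hws hwg h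
  · exact hsol.lt_of_onDescentPath hclosed hbdry hScont hSpos hSbdd hs hg hw hws hwg h
  · exact hsol.lt_of_onBidirectionalPath hclosed hbdry hScont hSpos hSbdd hs hg hw hws hwg h
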